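/- Let $\mathcal G$ be the belt buckle: the graph with two vertices joined by three edges $e_1,e_2,e_3$. Replace each edge $e$ by two opposite directed edges $e,\bar e$, let $A$ be the $6\times 6$ $0$-$1$ matrix with $A(d,d')=1$ iff $d'$ begins where $d$ ends and $d'\neq\bar d$, and let $\Sigma_A^+$ be the one-sided subshift of finite type of $A$, with shift $\sigma$. A function $\varphi$ on the edges is regarded as the function $\underline e\mapsto \varphi(e_0)$ on $\Sigma_A^+$, where $e_0$ is the zeroth edge of $\underline e$. For an edge weighting $l:\{e_1,e_2,e_3\}\to\mathbb R_{>0}$ the entropy is $h(l)=\lim_{T\to\infty}\frac1T\log\#\{\gamma:\ l(\gamma)<T\}$, where $\gamma=(d_0,\dots,d_n=d_0)$, $n\ge 1$, runs over the closed cycles of directed edges with $A(d_i,d_{i+1})=1$ for all $0\le i<n$, and $l(\gamma)=\sum_{i<n}l(d_i)$. Let $\mathcal M^1_{\mathcal G}=\{l>0:\ h(l)=1\}$. For $f\in C(\Sigma_A^+)$ let $(\mathcal L_fw)(\underline x)=\sum_{\sigma\underline y=\underline x}e^{f(\underline y)}w(\underline y)$, and let $P(f)$ be the logarithm of the spectral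 radius of $\mathcal L_f$ on the complex-valued continuous functions. For $l\in\mathcal M^1_{\mathcal G}$ one has $P(-l)=0$, and $m_{-l}$ denotes the equilibrium state of $-l$, i.e. the unique probability measure of the form $v\mu/\int v\,d\mu$ with $v>0$ continuous, $\mathcal L_{-l}v=v$, and $\mu$ a probability measure with $\mathcal L_{-l}^*\mu=\mu$. The tangent space at $l$ consists of the functions $\varphi$ on $\Sigma_A^+$ that depend only on the zeroth directed edge and satisfy $\int\varphi\,dm_{-l}=0$, and the pressure metric on it is $$\|\varphi\|_P^2=\mathrm{Var}(\varphi,m_{-l})=\lim_{n\to\infty}\frac1n\int\Big(\sum_{i<n}\varphi\circ\sigma^i-n\int\varphi\,dm_{-l}\Big)^2dm_{-l}.$$ Put $A_{-l}(i,j)=A(i,j)e^{-l(i)}$, let $\mathbf v>0$ satisfy $\mathbf vA_{-l}=\mathbf v$, put $P_{-l}(i,j)=A(i,j)\mathbf v(i)e^{-l(i)}/\mathbf v(j)$, and let $\mathbf p$ be the unique vector with $P_{-l}\mathbf p=\mathbf p$ and $\sum_i\mathbf p(i)=1$; $\mathbf p_3$ is its entry at the directed edge $e_3$. Let $S(x,y)=-\log\frac{e^{x+y}-1}{e^x+e^y+2}$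 and $l(x,y)=(x,y,S(x,y))$. **Proposition.** The map $(x,y)\mapsto l(x,y)$ is a bijection from $\{(x,y):\ x>0,\ y>0,\ e^{x+y}<3+e^x+e^y\}$ onto $\mathcal M^1_{\mathcal G}$. At each such $(x,y)$ the measure $m_{-l}$ and the vector $\mathbf p$ exist and are unique, $\frac{\partial l}{\partial x}$ and $\frac{\partial l}{\partial y}$ are tangent vectors at $l=l(x,y)$, and the first fundamental form of $(\mathcal M^1_{\mathcal G},\|\cdot\|_P)$ in the coordinates $(x,y)$ is given by $$\begin{aligned} E_P&=\mathrm{Var}\Big(\frac{\partial l}{\partial x},m_{-l}\Big)=2\,\frac{\partial^2S}{\partial x^2}\,\mathbf p_3=\frac{e^x(e^y+1)^2(e^{2x+y}+e^y+2)}{2(e^x+e^y+2)(e^{x+y}-1)(3e^{x+y}+e^{2x+y}+e^{x+2y}-1)},\\ F_P&=\frac12\Big(\mathrm{Var}\Big(\frac{\partial l}{\partial x}+\frac{\partial l}{\partial y},m_{-l}\Big)-\mathrm{Var}\Big(\frac{\partial l}{\partial x},m_{-l}\Big)-\mathrm{Var}\Big(\frac{\partial l}{\partial y},m_{-l}\Big)\Big)=2\,\frac{\partial^2S}{\partial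 x\partial y}\,\mathbf p_3\\ &=\frac{(e^x+1)(e^y+1)e^{x+y}(-e^{x+y}+e^x+e^y+3)}{2(e^x+e^y+2)(e^{x+y}-1)(3e^{x+y}+e^{2x+y}+e^{x+2y}-1)},\\ G_P&=\mathrm{Var}\Big(\frac{\partial l}{\partial y},m_{-l}\Big)=2\,\frac{\partial^2S}{\partial y^2}\,\mathbf p_3=\frac{(e^x+1)^2e^y(e^{x+2y}+e^x+2)}{2(e^x+e^y+2)(e^{x+y}-1)(3e^{x+y}+e^{2x+y}+e^{x+2y}-1)}; \end{aligned}$$ that is, $\big\|a\frac{\partial l}{\partial x}+b\frac{\partial l}{\partial y}\big\|_P^2=a^2E_P+2ab\,F_P+b^2G_P$ for all $a,b\in\mathbb R$, all the variances existing as limits. -/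

import Mathlib

open Filter Topology MeasureTheory

noncomputable section

/-! ## One-sided subshifts of finite type -/

/-- The one-sided subshift of finite type `Σ_A⁺` of a 0-1 matrix `A`. -/
def Subshift {ι : Type*} (A : Matrix ι ι ℕ) : Type _ :=
  {x : ℕ → ι // ∀ n, A (x n) (x (n + 1)) = 1}

namespace Subshift

variable {ι : Type*} [Fintype ι] [TopologicalSpace ι] [DiscreteTopology ι]
  {A : Matrix ι ι ℕ}

/-- The subspace topology of the product topology (the alphabet being discrete). -/
instance : TopologicalSpace (Subshift A) :=
  inferInstanceAs (TopologicalSpace {x : ℕ → ι // ∀ n, A (x n) (x (n + 1)) = 1})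

instance : MeasurableSpace (Subshift A) := borel _

instance : BorelSpace (Subshift A) := ⟨rfl⟩

instance : T2Space (Subshift A) :=
  inferInstanceAs (T2Space {x : ℕ → ι // ∀ n, A (x n) (x (n + 1)) = 1})

instance : CompactSpace (Subshift A) := by
  have hc : IsClosed {x : ℕ → ι | ∀ n, A (x n) (x (n + 1)) = 1} := by
    rw [Set.ofPred_forall]
    refine isClosed_iInter fun n => ?_
    have h : Continuous fun x : ℕ → ι => (x n, x (n + 1)) := by fun_prop
    exact (isClosed_discrete {q : ι × ι | A q.1 q.2 = 1}).preimage h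
  exact isCompact_iff_compactSpace.mp hc.isCompact

/-- The letter at place `n`. -/
def coord (n : ℕ) (x : Subshift A) : ι := x.1 n

/-- The shift map, `(σ x)ₙ = xₙ₊₁`. -/
def shift (x : Subshift A) : Subshift A := ⟨fun n => x.1 (n + 1), fun n => x.2 (n + 1)⟩

/-- The sequence `i x₀ x₁ x₂ …`, admissible when `A(i, x₀) = 1`. -/
def cons (i : ι) (x : Subshift A) (h : A i (coord 0 x) = 1) : Subshift A :=
  ⟨fun n => Nat.casesOn n i x.1, fun n => by cases n with
    | zero => exact h
    | succ k => exact x.2 k⟩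

end Subshift

namespace Subshift

/-- The points `cons i x` are exactly the preimages of `x` under the shift. -/
theorem shift_eq_iff {ι : Type*} {A : Matrix ι ι ℕ} (x y : Subshift A) :
    shift y = x ↔ ∃ (i : ι) (h : A i (coord 0 x) = 1), y = cons i x h := by
  constructor
  · rintro rfl
    refine ⟨y.1 0, y.2 0, Subtype.ext (funext fun n => ?_)⟩
    cases n <;> rfl
  · rintro ⟨i, h, rfl⟩
    rfl

theorem continuous_coord {ι : Type*} [TopologicalSpace ι] {A : Matrix ι ι ℕ} (n : ℕ) :
    Continuous (coord n : Subshift A → ι) :=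
  (continuous_apply n).comp continuous_subtype_val

variable {ι : Type*} [Fintype ι] [TopologicalSpace ι] [DiscreteTopology ι]
  {A : Matrix ι ι ℕ}

/-- The transfer operator `(L_f w)(x) = ∑_{σ y = x} e^{f(y)} w(y)`, for functions with values in a
real vector space; the preimages of `x` are the points `cons i x`. -/
def transfer {F : Type*} [AddCommGroup F] [Module ℝ F] (f : Subshift A → ℝ)
    (w : Subshift A → F) (x : Subshift A) : F :=
  ∑ i, if h : A i (coord 0 x) = 1 then Real.exp (f (cons i x h)) • w (cons i x h) else 0

theorem continuous_transfer {F : Type*} [NormedAddCommGroup F] [NormedSpace ℝ F]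
    {f : Subshift A → ℝ} (hf : Continuous f) {w : Subshift A → F} (hw : Continuous w) :
    Continuous (transfer f w) := by
  refine continuous_finsetSum _ fun i _ => ?_
  have hU : IsClopen {x : Subshift A | A i (coord 0 x) = 1} :=
    (isClopen_discrete {j : ι | A i j = 1}).preimage (continuous_coord 0)
  have hcons : Continuous
      fun x : {x : Subshift A | A i (coord 0 x) = 1} => cons i x.1 x.2 := by
    refine Continuous.subtype_mk (continuous_pi fun n => ?_) _
    cases n with
    | zero => exact continuous_const
    | succ k => exact (continuous_coord k).comp continuous_subtype_val
  rw [← continuousOn_univ, ← Set.union_compl_self {x : Subshift A | A i (coord 0 x) = 1}]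
  refine ContinuousOn.union_of_isOpen ?_ ?_ hU.isOpen hU.compl.isOpen
  · rw [continuousOn_iff_continuous_domRestrict]
    refine (((Real.continuous_exp.comp (hf.comp hcons)).smul (hw.comp hcons))).congr fun x => ?_
    have hx : A i (coord 0 x.1) = 1 := x.2
    simp [hx]
  · refine (continuousOn_const (c := (0 : F))).congr fun x hx => ?_
    have hx' : ¬ A i (coord 0 x) = 1 := hx
    simp [hx']

/-- The transfer operator as a bounded operator on the Banach space `C(Σ_A⁺, ℂ)`. -/
def transferCLM (f : C(Subshift A, ℝ)) : C(Subshift A, ℂ) →L[ℂ] C(Subshift A, ℂ) :=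
  LinearMap.mkContinuous
    { toFun := fun w => ⟨transfer f w, continuous_transfer f.continuous w.continuous⟩
      map_add' := fun w w' => by
        ext x
        simp only [transfer, ContinuousMap.coe_mk, ContinuousMap.add_apply,
          ← Finset.sum_add_distrib]
        refine Finset.sum_congr rfl fun i _ => ?_
        split_ifs <;> simp
      map_smul' := fun c w => by
        ext x
        simp only [transfer, ContinuousMap.coe_mk, ContinuousMap.smul_apply, RingHom.id_apply,
          Finset.smul_sum]
        refine Finset.sum_congr rfl fun i _ => ?_
        split_ifs
        · exact smul_comm _ _ _
        · simp }
    (Fintype.card ι * Real.exp ‖f‖) (fun w => by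
      rw [ContinuousMap.norm_le _ (by positivity)]
      intro x
      calc ‖transfer f w x‖ ≤ ∑ _i : ι, Real.exp ‖f‖ * ‖w‖ := by
            refine norm_sum_le_of_le _ fun i _ => ?_
            split_ifs with h
            · rw [norm_smul, Real.norm_eq_abs, Real.abs_exp]
              gcongr
              · exact (Real.le_norm_self _).trans (f.norm_coe_le_norm _)
              · exact w.norm_coe_le_norm _
            · rw [norm_zero]; positivity
        _ = Fintype.card ι * Real.exp ‖f‖ * ‖w‖ := by
            simp [Finset.sum_const, nsmul_eq_mul, mul_assoc])

/-- The pressure `P(f)`: the logarithm of the spectral radius of the transfer operator. -/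
def pressure (f : C(Subshift A, ℝ)) : ℝ :=
  Real.log (spectralRadius ℂ (transferCLM f)).toReal

/-- `m` is an equilibrium state of `f`, where `P(f) = 0`: it is `v μ / ∫ v dμ` for a strictly
positive continuous eigenfunction `v` of `L_f` and a probability measure `μ` which is an
eigenvector of the dual of `L_f`, both for the eigenvalue `β_f = e^{P(f)}`. -/
def IsEquilibriumState (f : C(Subshift A, ℝ)) (m : Measure (Subshift A)) : Prop :=
  pressure f = 0 ∧
  ∃ (v : C(Subshift A, ℝ)) (μ : Measure (Subshift A)),
    (∀ x, 0 < v x) ∧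
    (∀ x, transfer f v x = Real.exp (pressure f) * v x) ∧
    IsProbabilityMeasure μ ∧
    (∀ φ : C(Subshift A, ℝ),
      ∫ x, transfer f φ x ∂μ = Real.exp (pressure f) * ∫ x, φ x ∂μ) ∧
    m = μ.withDensity fun x => ENNReal.ofReal (v x / ∫ z, v z ∂μ)

/-- `Var(w, μ) = V`, that is, `(1/n) ∫ (wⁿ - n ∫ w dμ)² dμ → V`, where `wⁿ` is the Birkhoff sum
`w + w ∘ σ + ⋯ + w ∘ σⁿ⁻¹`. -/
def HasVariance (w : Subshift A → ℝ) (μ : Measure (Subshift A)) (V : ℝ) : Prop :=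
  Tendsto (fun n : ℕ => (1 / (n : ℝ)) *
    ∫ x, (birkhoffSum shift w n x - n * ∫ z, w z ∂μ) ^ 2 ∂μ) atTop (𝓝 V)

end Subshift

/-! ## Metric graphs -/

/-- An undirected graph with vertex set `V` and edge set `E`, loops and multiple edges allowed.
The order in which the two endpoints of an edge are listed only serves to name its two
directions. -/
structure MultiGraph (V E : Type*) where
  endpt₀ : E → V
  endpt₁ : E → V

namespace MultiGraph

variable {V E : Type*}

/-- The directed edges: `(e, false)` is `e` run from `endpt₀ e` to `endpt₁ e`, and `(e, true)` is
the opposite directed edge. -/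
abbrev DirEdge (_G : MultiGraph V E) : Type _ := E × Bool

/-- The oppositely directed edge. -/
def opposite (G : MultiGraph V E) (d : G.DirEdge) : G.DirEdge := (d.1, !d.2)

/-- The vertex where a directed edge begins. -/
def origin (G : MultiGraph V E) (d : G.DirEdge) : V :=
  if d.2 then G.endpt₁ d.1 else G.endpt₀ d.1

/-- The vertex where a directed edge ends. -/
def terminus (G : MultiGraph V E) (d : G.DirEdge) : V :=
  if d.2 then G.endpt₀ d.1 else G.endpt₁ d.1

variable [DecidableEq V] [DecidableEq E]

/-- `A(d, d') = 1` if `d'` follows `d` and is not the opposite of `d`, and `0` otherwise. -/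
def adjMat (G : MultiGraph V E) : Matrix G.DirEdge G.DirEdge ℕ := fun d d' =>
  if G.origin d' = G.terminus d ∧ d' ≠ G.opposite d then 1 else 0

/-- The closed cycles `γ = (d₀, d₁, …, dₙ = d₀)`, `n ≥ 1`, of directed edges without
backtracking. -/
def IsClosedCycle (G : MultiGraph V E) (γ : List G.DirEdge) : Prop :=
  2 ≤ γ.length ∧ γ.IsChain (fun d d' => G.adjMat d d' = 1) ∧ γ.head? = γ.getLast?

/-- `l(γ) = l(d₀) + ⋯ + l(dₙ₋₁)` for `γ = (d₀, …, dₙ)`. -/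
def cycleLength (G : MultiGraph V E) (l : E → ℝ) (γ : List G.DirEdge) : ℝ :=
  (γ.dropLast.map fun d => l d.1).sum

/-- The metric graph `(G, l)` has entropy `h`:
`(1/T) log #{γ closed cycle; l(γ) < T} → h` as `T → ∞`. -/
def HasEntropy (G : MultiGraph V E) (l : E → ℝ) (h : ℝ) : Prop :=
  Tendsto (fun T : ℝ => (1 / T) *
    Real.log ({γ | G.IsClosedCycle γ ∧ G.cycleLength l γ < T}.ncard : ℝ)) atTop (𝓝 h)

/-- The moduli space of edge weightings `l : E → ℝ_{>0}` of entropy one. -/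
def moduliOne (G : MultiGraph V E) : Set (E → ℝ) :=
  {l | (∀ e, 0 < l e) ∧ G.HasEntropy l 1}

variable [Fintype E] [TopologicalSpace E] [DiscreteTopology E]

/-- A function on the edges as a locally constant function on `Σ_A⁺`, depending only on the
zeroth edge of a path. -/
def edgeFun (G : MultiGraph V E) (φ : E → ℝ) : C(Subshift G.adjMat, ℝ) :=
  ⟨fun x => φ (Subshift.coord 0 x).1,
    (continuous_of_discreteTopology (f := fun d : G.DirEdge => φ d.1)).comp
      (Subshift.continuous_coord 0)⟩

/-- The space of functions on `Σ_A⁺` which depend only on the zeroth directed edge and have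
`m`-integral zero; for the equilibrium state `m = m_{-l}` it is the tangent space at `l` to the
moduli space of entropy one. -/
def tangentSpace (G : MultiGraph V E) (m : Measure (Subshift G.adjMat)) :
    Set (Subshift G.adjMat → ℝ) :=
  {φ | (∃ φ₀ : G.DirEdge → ℝ, ∀ x, φ x = φ₀ (Subshift.coord 0 x)) ∧ ∫ x, φ x ∂m = 0}

/-- The weighted matrix `A_{-l}(i, j) = A(i, j) e^{-l(i)}`. -/
def weightedMat (G : MultiGraph V E) (l : E → ℝ) : Matrix G.DirEdge G.DirEdge ℝ := fun i j =>
  (G.adjMat i j : ℝ) * Real.exp (-l i.1)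

/-- The matrix `P_{-l}(i, j) = A(i, j) v(i) e^{-l(i)} / v(j)`. -/
def stochMat (G : MultiGraph V E) (l : E → ℝ) (v : G.DirEdge → ℝ) :
    Matrix G.DirEdge G.DirEdge ℝ := fun i j =>
  (G.adjMat i j : ℝ) * v i * Real.exp (-l i.1) / v j

/-- `p` is the vector `p_{-l}`: one has `P_{-l} p = p` and `∑ p(i) = 1`, where `P_{-l}` is formed
with a positive left eigenvector `v` of `A_{-l}` for the eigenvalue `1`. -/
def IsStationaryVec (G : MultiGraph V E) (l : E → ℝ) (p : G.DirEdge → ℝ) : Prop :=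
  ∃ v : G.DirEdge → ℝ, (∀ i, 0 < v i) ∧ Matrix.vecMul v (G.weightedMat l) = v ∧
    Matrix.mulVec (G.stochMat l v) p = p ∧ ∑ i, p i = 1

end MultiGraph

/-! ## The belt buckle -/

namespace BeltBuckle

/-- The belt buckle: two vertices joined by three edges `e₁ = 0`, `e₂ = 1`, `e₃ = 2`. -/
def graph : MultiGraph (Fin 2) (Fin 3) := ⟨fun _ => 0, fun _ => 1⟩

/-- `S(x, y) = -log ((e^{x+y} - 1) / (e^x + e^y + 2))`. -/
def S (x y : ℝ) : ℝ :=
  -Real.log ((Real.exp (x + y) - 1) / (Real.exp x + Real.exp y + 2))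

/-- The edge weighting `l(x, y) = (x, y, S(x, y))`. -/
def l (x y : ℝ) : Fin 3 → ℝ := ![x, y, S x y]

/-- The tangent vector `∂l/∂x` at `(x, y)`. -/
def dlx (x y : ℝ) : Fin 3 → ℝ := deriv (fun t => l t y) x

/-- The tangent vector `∂l/∂y` at `(x, y)`. -/
def dly (x y : ℝ) : Fin 3 → ℝ := deriv (fun t => l x t) y

/-- `∂²S/∂x²`. -/
def Sxx (x y : ℝ) : ℝ := deriv (fun t => deriv (fun s => S s y) t) x

/-- `∂²S/∂x∂y`. -/
def Sxy (x y : ℝ) : ℝ := deriv (fun s => deriv (fun t => S s t) y) x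

/-- `∂²S/∂y²`. -/
def Syy (x y : ℝ) : ℝ := deriv (fun t => deriv (fun s => S x s) t) y

/-- The domain of the coordinates `(x, y)`: all three edge lengths `x`, `y`, `S(x, y)` are
positive. -/
def domain : Set (ℝ × ℝ) :=
  {q | 0 < q.1 ∧ 0 < q.2 ∧ Real.exp (q.1 + q.2) < 3 + Real.exp q.1 + Real.exp q.2}

/-- The common denominator of the coefficients. -/
def denom (x y : ℝ) : ℝ :=
  2 * (Real.exp x + Real.exp y + 2) * (Real.exp (x + y) - 1) *
    (3 * Real.exp (x + y) + Real.exp (2 * x + y) + Real.exp (x + 2 * y) - 1)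

/-- The coefficient `E_P`. -/
def EP (x y : ℝ) : ℝ :=
  Real.exp x * (Real.exp y + 1) ^ 2 * (Real.exp (2 * x + y) + Real.exp y + 2) / denom x y

/-- The coefficient `F_P`. -/
def FP (x y : ℝ) : ℝ :=
  (Real.exp x + 1) * (Real.exp y + 1) * Real.exp (x + y) *
    (-Real.exp (x + y) + Real.exp x + Real.exp y + 3) / denom x y

/-- The coefficient `G_P`. -/
def GP (x y : ℝ) : ℝ :=
  (Real.exp x + 1) ^ 2 * Real.exp y * (Real.exp (x + 2 * y) + Real.exp x + 2) / denom x y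

end BeltBuckle

end

/-!
Write `σ` for the sigmoid function. The vectors `σ(l)` and `σ(-l)` are left and right eigenvectors
of `A_{-l}` for the eigenvalue `1` as soon as `∑ σ(-lₑ) = 1`. If this equation holds for `δ l`, a
renewal induction compares the number of paths of length less than `T` with `σ(-δ l) e^{δT}`, so
the entropy is `δ`. The surface of entropy one is therefore `∑ σ(-lₑ) = 1`, which is the graph of
`S`.

The eigenvectors also determine the equilibrium state `m`, under which an edge has a mass
proportional to `σ'(l)`. A tangent vector satisfies `∑ φₑ σ'(lₑ) = 0`, and this is exactly what
makes `u = φ σ(l)` and `g = -φ σ(-l)` solve `L(u h) = g h`, where `h = σ(l)`. Then `u - g ∘ shift`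
is a reverse martingale difference cohomologous to `φ = u - g`, so the variance is
`∫ (u² - g²) dm = -∑ φₑ² σ''(lₑ) / ∑ σ'(lₑ)`. Differentiating the equation of the surface twice
turns this into the Hessian of `S` times `2 𝐩₃`, where `𝐩₃ = σ'(S) / (2 ∑ σ'(lₑ))`.
-/

/-! ### Eigenvectors and invariant functionals of positive operators -/

theorem exists_eq_smul_of_mulVec_eq_self {ι : Type*} [Fintype ι] {B : Matrix ι ι ℝ}
    (hB : ∀ i j, 0 ≤ B i j) (hirr : ∀ i j, Relation.ReflTransGen (fun i j => 0 < B i j) i j)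
    {u w : ι → ℝ} (hu : ∀ i, 0 < u i) (hBu : B.mulVec u = u) (hBw : B.mulVec w = w) :
    ∃ c : ℝ, w = c • u := by
  rcases isEmpty_or_nonempty ι with hι | hι
  · exact ⟨0, Subsingleton.elim _ _⟩
  obtain ⟨i₀, hi₀⟩ := Finite.exists_max fun i => w i / u i
  set c := w i₀ / u i₀ with hc
  set d : ι → ℝ := c • u - w with hd
  have d_nonneg (i) : 0 ≤ d i := sub_nonneg.2 ((div_le_iff₀ (hu i)).1 (hi₀ i))
  have B_d : B.mulVec d = d := by rw [hd, Matrix.mulVec_sub, Matrix.mulVec_smul, hBu, hBw]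
  have d_eq_zero (j) : d j = 0 := by
    induction hirr i₀ j with
    | refl => simp [hd, hc, (hu i₀).ne']
    | @tail i j _ hij ih =>
      have hsum : ∑ k, B i k * d k = 0 := (congrFun B_d i).trans ih
      have hterm := (Finset.sum_eq_zero_iff_of_nonneg
        fun k _ => mul_nonneg (hB i k) (d_nonneg k)).1 hsum j (Finset.mem_univ j)
      exact (mul_eq_zero.1 hterm).resolve_left hij.ne'
  exact ⟨c, funext fun j => (sub_eq_zero.1 (d_eq_zero j)).symm⟩

section InvariantMeasure

variable {X : Type*} [TopologicalSpace X] [CompactSpace X] [Nonempty X]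
  {T : C(X, ℝ) →ₚ[ℝ] C(X, ℝ)} {h : C(X, ℝ)}

theorem exists_map_apply_le_apply (hpos : ∀ x, 0 < h x) (hTh : T h = h) (w : C(X, ℝ)) :
    ∃ x, T w x ≤ w x := by
  obtain ⟨x, -, hx⟩ := isCompact_univ.exists_isMaxOn Set.univ_nonempty
    (w.continuous.div h.continuous fun y => (hpos y).ne').continuousOn
  have w_le : w ≤ (w x / h x) • h := fun y => (div_le_iff₀ (hpos y)).1 (hx (Set.mem_univ y))
  refine ⟨x, ?_⟩
  calc T w x ≤ T ((w x / h x) • h) x := T.monotone' w_le x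
    _ = w x / h x * h x := by rw [map_smul, hTh]; rfl
    _ = w x := div_mul_cancel₀ _ (hpos x).ne'

theorem nonneg_of_map_sub_le_smul (hpos : ∀ x, 0 < h x) (hTh : T h = h) {v : C(X, ℝ)} {c : ℝ}
    (hv : T v - v ≤ c • h) : 0 ≤ c := by
  obtain ⟨x, hx⟩ := exists_map_apply_le_apply hpos hTh (-v)
  rw [map_neg, ContinuousMap.neg_apply, ContinuousMap.neg_apply, neg_le_neg_iff] at hx
  have h_eval : T v x - v x ≤ c * h x := hv x
  exact nonneg_of_mul_nonneg_left ((sub_nonneg.2 hx).trans h_eval) (hpos x)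

theorem exists_positiveLinearMap_comp_eq (hpos : ∀ x, 0 < h x) (hTh : T h = h) :
    ∃ Λ : C(X, ℝ) →ₚ[ℝ] ℝ, Λ h = 1 ∧ ∀ w, Λ (T w) = Λ w := by
  -- Functionals nonnegative on this cone are exactly the `T`-invariant positive ones.
  let D : C(X, ℝ) →ₗ[ℝ] C(X, ℝ) := T.toLinearMap - LinearMap.id
  let K : PointedCone ℝ C(X, ℝ) := PointedCone.positive ℝ C(X, ℝ) ⊔ PointedCone.ofSubmodule D.range
  have D_mem (w) : D w ∈ K := Submodule.mem_sup_right (LinearMap.mem_range_self D w)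
  have mem_of_nonneg {w} (hw : 0 ≤ w) : w ∈ K := Submodule.mem_sup_left hw
  have h_ne : h ≠ 0 := fun h0 => (hpos (Classical.arbitrary X)).ne' (by rw [h0]; rfl)
  have nonneg_of_smul_mem (c : ℝ) (hc : c • h ∈ K) : 0 ≤ c := by
    obtain ⟨w, hw, _, ⟨v, rfl⟩, hwv⟩ := Submodule.mem_sup.1 hc
    exact nonneg_of_map_sub_le_smul hpos hTh (hwv ▸ le_add_of_nonneg_left hw)
  obtain ⟨x₁, -, hx₁⟩ := isCompact_univ.exists_isMinOn Set.univ_nonempty h.continuous.continuousOn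
  obtain ⟨Λ, hΛ, hΛK⟩ := riesz_extension K (LinearPMap.mkSpanSingleton h (1 : ℝ) h_ne)
    (by
      rintro ⟨_, hx⟩ hxK
      obtain ⟨c, rfl⟩ := Submodule.mem_span_singleton.1 hx
      rw [LinearPMap.mkSpanSingleton'_apply]
      simpa using nonneg_of_smul_mem c hxK)
    (fun w => ⟨⟨(‖w‖ / h x₁) • h, Submodule.smul_mem _ _ (Submodule.mem_span_singleton_self h)⟩,
      mem_of_nonneg fun x => neg_le_iff_add_nonneg.1 <|
        calc -w x ≤ ‖w‖ := (neg_le_abs _).trans (w.norm_coe_le_norm x)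
          _ = ‖w‖ / h x₁ * h x₁ := (div_mul_cancel₀ _ (hpos x₁).ne').symm
          _ ≤ ‖w‖ / h x₁ * h x := by
            gcongr
            exacts [div_nonneg (norm_nonneg _) (hpos x₁).le, hx₁ (Set.mem_univ x)]⟩)
  refine ⟨.mk₀ Λ fun w hw => hΛK w (mem_of_nonneg hw), ?_, fun w => ?_⟩
  · exact (hΛ ⟨h, Submodule.mem_span_singleton_self h⟩).trans
      (LinearPMap.mkSpanSingleton_apply ℝ ℝ h_ne 1)
  · have map_D (v) : Λ (D v) = Λ (T v) - Λ v := map_sub Λ (T v) v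
    have h₁ := hΛK _ (D_mem w)
    have h₂ := hΛK _ (D_mem (-w))
    rw [map_D] at h₁
    rw [map_neg, map_neg, map_D] at h₂
    exact le_antisymm (sub_nonpos.1 (neg_nonneg.1 h₂)) (sub_nonneg.1 h₁)

variable [T2Space X] [MeasurableSpace X] [BorelSpace X]

theorem exists_isProbabilityMeasure_integral_map_eq (hpos : ∀ x, 0 < h x) (hTh : T h = h) :
    ∃ μ : Measure X, IsProbabilityMeasure μ ∧
      ∀ φ : C(X, ℝ), ∫ x, T φ x ∂μ = ∫ x, φ x ∂μ := by
  obtain ⟨Λ, hΛh, hΛT⟩ := exists_positiveLinearMap_comp_eq hpos hTh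
  let Λc : CompactlySupportedContinuousMap X ℝ →ₚ[ℝ] ℝ :=
    { toFun := fun g => Λ g.toContinuousMap
      map_add' := fun g g' => map_add Λ g.toContinuousMap g'.toContinuousMap
      map_smul' := fun c g => map_smul Λ c g.toContinuousMap
      monotone' := fun _ _ hg => Λ.monotone' hg }
  set μ := RealRMK.rieszMeasure Λc
  have integral_eq (w : C(X, ℝ)) : ∫ x, w x ∂μ = Λ w :=
    RealRMK.integral_rieszMeasure Λc ⟨w, HasCompactSupport.of_compactSpace w⟩
  have : NeZero μ := ⟨fun h0 => by
    have := integral_eq h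
    rw [h0, integral_zero_measure, hΛh] at this
    exact zero_ne_one this⟩
  refine ⟨(μ Set.univ)⁻¹ • μ, inferInstance, fun φ => ?_⟩
  rw [integral_smul_measure, integral_smul_measure, integral_eq, integral_eq, hΛT]

end InvariantMeasure

/-! ### Cylinders and transfer operators -/

namespace Subshift

section Cylinders

variable {ι : Type*} {A : Matrix ι ι ℕ}

@[simp] theorem shift_cons (i : ι) (x : Subshift A) (h : A i (coord 0 x) = 1) :
    shift (cons i x h) = x := rfl

/-- The cylinder of the points that begin with `s₀, …, sₙ₋₁`. -/
def cylinder (s : ℕ → ι) (n : ℕ) : Set (Subshift A) := {x | ∀ k < n, coord k x = s k}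

theorem cons_mem_cylinder {s : ℕ → ι} {n : ℕ} {i : ι} {x : Subshift A}
    (h : A i (coord 0 x) = 1) :
    cons i x h ∈ cylinder s (n + 1) ↔ i = s 0 ∧ x ∈ cylinder (fun k => s (k + 1)) n := by
  constructor
  · intro hx
    exact ⟨hx 0 n.succ_pos, fun k hk => hx (k + 1) (Nat.succ_lt_succ hk)⟩
  · rintro ⟨hi, hx⟩ k hk
    cases k with
    | zero => exact hi
    | succ k => exact hx k (Nat.lt_of_succ_lt_succ hk)

theorem isPiSystem_cylinder : IsPiSystem {S : Set (Subshift A) | ∃ s n, S = cylinder s n} := by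
  rintro _ ⟨s, n, rfl⟩ _ ⟨s', n', rfl⟩ ⟨x, hx, hx'⟩
  refine ⟨x.1, max n n', Set.ext fun y => ⟨fun hy k hk => ?_, fun hy => ⟨fun k hk => ?_,
    fun k hk => ?_⟩⟩⟩
  · rcases lt_max_iff.1 hk with hk | hk
    · exact (hy.1 k hk).trans (hx k hk).symm
    · exact (hy.2 k hk).trans (hx' k hk).symm
  · exact (hy k (lt_max_of_lt_left hk)).trans (hx k hk)
  · exact (hy k (lt_max_of_lt_right hk)).trans (hx' k hk)

variable [TopologicalSpace ι]

theorem continuous_shift : Continuous (shift : Subshift A → Subshift A) :=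
  Continuous.subtype_mk (continuous_pi fun n => continuous_coord (n + 1)) _

variable [DiscreteTopology ι]

theorem isClopen_cylinder (s : ℕ → ι) (n : ℕ) : IsClopen (cylinder s n : Set (Subshift A)) := by
  have cylinder_eq : (cylinder s n : Set (Subshift A)) = ⋂ k ∈ Set.Iio n, coord k ⁻¹' {s k} := by
    ext x
    simp [cylinder]
  rw [cylinder_eq]
  exact (Set.finite_Iio n).isClopen_biInter fun k _ =>
    (isClopen_discrete {s k}).preimage (continuous_coord k)

theorem isTopologicalBasis_cylinder :
    TopologicalSpace.IsTopologicalBasis {S : Set (Subshift A) | ∃ s n, S = cylinder s n} := by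
  have image_eq : {S : Set (Subshift A) | ∃ s n, S = cylinder s n} =
      Set.preimage Subtype.val '' {S : Set (ℕ → ι) | ∃ s n, S = PiNat.cylinder s n} := by
    ext S
    constructor
    · rintro ⟨s, n, rfl⟩
      exact ⟨_, ⟨s, n, rfl⟩, rfl⟩
    · rintro ⟨_, ⟨s, n, rfl⟩, rfl⟩
      exact ⟨s, n, rfl⟩
  rw [image_eq]
  exact (PiNat.isTopologicalBasis_cylinders fun _ : ℕ => ι).induced _

theorem measure_ext_cylinder [Finite ι] {μ ν : Measure (Subshift A)} [IsFiniteMeasure μ]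
    (h : ∀ s n, μ (cylinder s n) = ν (cylinder s n)) : μ = ν := by
  have : SecondCountableTopology (Subshift A) :=
    TopologicalSpace.Subtype.secondCountableTopology _
  refine ext_of_generate_finite _ isTopologicalBasis_cylinder.borel_eq_generateFrom
    isPiSystem_cylinder ?_ ?_
  · rintro _ ⟨s, n, rfl⟩
    exact h s n
  · rcases isEmpty_or_nonempty ι with hι | ⟨⟨i⟩⟩
    · have : IsEmpty (Subshift A) := ⟨fun x => hι.elim (x.1 0)⟩
      simp only [Set.eq_empty_of_isEmpty, measure_empty]
    · have cylinder_zero : (cylinder (fun _ => i) 0 : Set (Subshift A)) = Set.univ :=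
        Set.eq_univ_of_forall fun x k hk => absurd hk k.not_lt_zero
      rw [← cylinder_zero]
      exact h _ 0

end Cylinders

section Transitive

variable {ι : Type*} {A : Matrix ι ι ℕ}

/-- Any two letters are joined by an admissible word; this makes the shift topologically
transitive. -/
def IsTransitive (A : Matrix ι ι ℕ) : Prop :=
  ∀ i j, Relation.ReflTransGen (fun i j => A i j = 1) i j

variable {s : Set (Subshift A)}

theorem exists_mem_coord_zero_eq (hA : IsTransitive A) (hs : s.Nonempty)
    (hcons : ∀ x ∈ s, ∀ i (h : A i (coord 0 x) = 1), cons i x h ∈ s) (j : ι) :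
    ∃ x ∈ s, coord 0 x = j := by
  obtain ⟨x₀, hx₀⟩ := hs
  induction hA j (coord 0 x₀) using Relation.ReflTransGen.head_induction_on with
  | refl => exact ⟨x₀, hx₀, rfl⟩
  | head hij _ ih =>
    obtain ⟨x, hx, rfl⟩ := ih
    exact ⟨cons _ x hij, hcons x hx _ hij, rfl⟩

theorem nonempty_inter_cylinder (hA : IsTransitive A) (hs : s.Nonempty)
    (hcons : ∀ x ∈ s, ∀ i (h : A i (coord 0 x) = 1), cons i x h ∈ s) (n : ℕ) (y : Subshift A) :
    (s ∩ cylinder y.1 (n + 1)).Nonempty := by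
  induction n generalizing y with
  | zero =>
    obtain ⟨x, hx, hxy⟩ := exists_mem_coord_zero_eq hA hs hcons (coord 0 y)
    refine ⟨x, hx, fun k hk => ?_⟩
    obtain rfl := Nat.lt_one_iff.1 hk
    exact hxy
  | succ n ih =>
    obtain ⟨x, hx, hxy⟩ := ih (shift y)
    have hyx : A (coord 0 y) (coord 0 x) = 1 := by
      rw [hxy 0 n.succ_pos]
      exact y.2 0
    exact ⟨cons (coord 0 y) x hyx, hcons x hx _ hyx, (cons_mem_cylinder hyx).2 ⟨rfl, hxy⟩⟩

theorem eq_univ_of_isClosed_of_cons_mem [TopologicalSpace ι] [DiscreteTopology ι]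
    (hA : IsTransitive A) (hs : s.Nonempty) (hclosed : IsClosed s)
    (hcons : ∀ x ∈ s, ∀ i (h : A i (coord 0 x) = 1), cons i x h ∈ s) : s = Set.univ := by
  refine Set.eq_univ_of_forall fun y => hclosed.closure_eq ▸
    isTopologicalBasis_cylinder.mem_closure_iff.2 ?_
  rintro _ ⟨t, n, rfl⟩ hy
  obtain ⟨x, hx, hxy⟩ := nonempty_inter_cylinder hA hs hcons n y
  exact ⟨x, fun k hk => (hxy k (hk.trans n.lt_succ_self)).trans (hy k hk), hx⟩

end Transitive

section Transfer

variable {ι : Type*} [Fintype ι] {A : Matrix ι ι ℕ}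

theorem transfer_mul_comp_shift (f φ w : Subshift A → ℝ) (x : Subshift A) :
    transfer f (fun y => φ (shift y) * w y) x = φ x * transfer f w x := by
  simp only [transfer, Finset.mul_sum]
  refine Finset.sum_congr rfl fun i _ => ?_
  split_ifs with h
  · rw [shift_cons, smul_eq_mul, smul_eq_mul]
    ring
  · rw [mul_zero]

theorem transfer_nonneg {f w : Subshift A → ℝ} (hw : ∀ x, 0 ≤ w x) (x : Subshift A) :
    0 ≤ transfer f w x := by
  refine Finset.sum_nonneg fun i _ => ?_
  split_ifs with h
  · exact mul_nonneg (Real.exp_pos _).le (hw _)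
  · exact le_rfl

theorem eq_zero_of_transfer_eq_zero {f w : Subshift A → ℝ} (hw : ∀ x, 0 ≤ w x) {x : Subshift A}
    (hx : transfer f w x = 0) {i : ι} (hi : A i (coord 0 x) = 1) : w (cons i x hi) = 0 := by
  have term_nonneg (j : ι) (_ : j ∈ Finset.univ) :
      0 ≤ if h : A j (coord 0 x) = 1 then Real.exp (f (cons j x h)) • w (cons j x h) else 0 := by
    split_ifs with h
    · exact mul_nonneg (Real.exp_pos _).le (hw _)
    · exact le_rfl
  have term_zero := (Finset.sum_eq_zero_iff_of_nonneg term_nonneg).1 hx i (Finset.mem_univ i)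
  rw [dif_pos hi] at term_zero
  exact (smul_eq_zero.1 term_zero).resolve_left (Real.exp_ne_zero _)

variable [TopologicalSpace ι] [DiscreteTopology ι]

/-- The transfer operator on real-valued continuous functions, as a positive operator. -/
noncomputable def transferPos (f : C(Subshift A, ℝ)) : C(Subshift A, ℝ) →ₚ[ℝ] C(Subshift A, ℝ) :=
  .mk₀
    { toFun := fun w => ⟨transfer f w, continuous_transfer f.continuous w.continuous⟩
      map_add' := fun w w' => by
        ext x
        simp only [transfer, ContinuousMap.coe_mk, ContinuousMap.add_apply,
          ← Finset.sum_add_distrib]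
        refine Finset.sum_congr rfl fun i _ => ?_
        split_ifs
        · exact smul_add _ _ _
        · exact (add_zero 0).symm
      map_smul' := fun c w => by
        ext x
        simp only [transfer, ContinuousMap.coe_mk, ContinuousMap.smul_apply, RingHom.id_apply,
          Finset.smul_sum]
        refine Finset.sum_congr rfl fun i _ => ?_
        split_ifs
        · exact smul_comm _ _ _
        · exact (smul_zero c).symm }
    fun _ hw x => transfer_nonneg hw x

variable {f h v : C(Subshift A, ℝ)}

theorem exists_eq_smul_of_transferPos_eq (hA : IsTransitive A) (hpos : ∀ x, 0 < h x)
    (hfix : transferPos f h = h) (hv : transferPos f v = v) : ∃ c : ℝ, v = c • h := by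
  rcases isEmpty_or_nonempty (Subshift A) with hX | hX
  · exact ⟨0, ContinuousMap.ext fun x => hX.elim x⟩
  obtain ⟨x₀, -, hx₀⟩ := isCompact_univ.exists_isMaxOn (Set.univ_nonempty (α := Subshift A))
    (v.continuous.div h.continuous fun x => (hpos x).ne').continuousOn
  set c := v x₀ / h x₀ with hc
  set d : C(Subshift A, ℝ) := c • h - v with hd
  have d_nonneg (x) : 0 ≤ d x := sub_nonneg.2 ((div_le_iff₀ (hpos x)).1 (hx₀ (Set.mem_univ x)))
  have transfer_d : transferPos f d = d := by rw [hd, map_sub, map_smul, hfix, hv]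
  have zeros_eq_univ : {x | d x = 0} = Set.univ :=
    eq_univ_of_isClosed_of_cons_mem hA ⟨x₀, by simp [hd, hc, (hpos x₀).ne']⟩
      (isClosed_singleton.preimage d.continuous) fun x hx i hi =>
        eq_zero_of_transfer_eq_zero d_nonneg ((DFunLike.congr_fun transfer_d x).trans hx) hi
  refine ⟨c, ContinuousMap.ext fun x => ?_⟩
  have d_eq_zero : x ∈ {x | d x = 0} := zeros_eq_univ ▸ Set.mem_univ x
  exact (sub_eq_zero.1 d_eq_zero).symm

end Transfer

end Subshift

section SpectralRadius

theorem spectralRadius_le_one_of_norm_pow_le {R : Type*} [NormedRing R] [NormedAlgebra ℂ R]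
    [CompleteSpace R] {a : R} {K : ℝ} (h : ∀ n, ‖a ^ n‖ ≤ K) : spectralRadius ℂ a ≤ 1 := by
  refine iSup₂_le fun z hz => ?_
  by_contra! hlt
  have one_lt_norm : 1 < ‖z‖ := by exact_mod_cast hlt
  obtain ⟨n, hn⟩ := ((tendsto_pow_atTop_atTop_of_one_lt one_lt_norm).eventually_gt_atTop
    (K * ‖(1 : R)‖)).exists
  have norm_pow_le := calc
    ‖z‖ ^ n = ‖z ^ n‖ := (norm_pow z n).symm
    _ ≤ ‖a ^ n‖ * ‖(1 : R)‖ := spectrum.norm_le_norm_mul_of_mem (spectrum.pow_mem_pow a n hz)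
    _ ≤ K * ‖(1 : R)‖ := mul_le_mul_of_nonneg_right (h n) (norm_nonneg _)
  exact hn.not_ge norm_pow_le

theorem one_le_spectralRadius_of_apply_eq_self {E : Type*} [NormedAddCommGroup E]
    [NormedSpace ℂ E] {T : E →L[ℂ] E} {w : E} (hw : w ≠ 0) (hT : T w = w) :
    1 ≤ spectralRadius ℂ T := by
  have one_mem : (1 : ℂ) ∈ spectrum ℂ T := by
    intro hunit
    obtain ⟨R, hR⟩ := hunit.exists_left_inv
    have hRw : R (algebraMap ℂ (E →L[ℂ] E) 1 w - T w) = w := DFunLike.congr_fun hR w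
    rw [map_one, one_apply_eq_self, hT, sub_self, map_zero] at hRw
    exact hw hRw.symm
  calc (1 : ENNReal) = ‖(1 : ℂ)‖₊ := by simp
    _ ≤ spectralRadius ℂ T := le_iSup₂ (α := ENNReal)
      (f := fun z (_ : z ∈ spectrum ℂ T) => (‖z‖₊ : ENNReal)) 1 one_mem

end SpectralRadius

theorem integrable_of_compactSpace {X : Type*} [TopologicalSpace X] [CompactSpace X]
    [MeasurableSpace X] [OpensMeasurableSpace X] {μ : Measure X} [IsFiniteMeasure μ] {φ : X → ℝ}
    (hφ : Continuous φ) : Integrable φ μ :=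
  hφ.integrable_of_hasCompactSupport (.of_compactSpace φ)

section NormalizedDensity

variable {X : Type*} [TopologicalSpace X] [MeasurableSpace X] {μ : Measure X} {h : C(X, ℝ)}

/-- The measure `h μ / ∫ h dμ`; this is how an equilibrium state is obtained from an eigenfunction
`h` of the transfer operator and an eigenmeasure `μ` of its dual. -/
noncomputable def normalizedDensity (h : C(X, ℝ)) (μ : Measure X) : Measure X :=
  μ.withDensity fun x => ENNReal.ofReal (h x / ∫ z, h z ∂μ)

theorem normalizedDensity_smul {c : ℝ} (hc : c ≠ 0) :
    normalizedDensity (c • h) μ = normalizedDensity h μ := by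
  simp only [normalizedDensity, ContinuousMap.smul_apply, smul_eq_mul, integral_const_mul,
    mul_div_mul_left _ _ hc]

variable [CompactSpace X] [BorelSpace X] [IsProbabilityMeasure μ]

theorem integral_pos_of_pos (hpos : ∀ x, 0 < h x) : 0 < ∫ x, h x ∂μ := by
  rw [integral_pos_iff_support_of_nonneg (fun x => (hpos x).le)
    (integrable_of_compactSpace h.continuous),
    Set.eq_univ_of_forall (s := Function.support h) fun x => (hpos x).ne', measure_univ]
  exact one_pos

theorem integral_normalizedDensity (hpos : ∀ x, 0 < h x) (g : X → ℝ) :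
    ∫ x, g x ∂normalizedDensity h μ = (∫ x, g x * h x ∂μ) / ∫ x, h x ∂μ := by
  have density_nonneg (x) : 0 ≤ h x / ∫ z, h z ∂μ :=
    div_nonneg (hpos x).le (integral_pos_of_pos hpos).le
  rw [normalizedDensity, integral_withDensity_eq_integral_toReal_smul
    (h.continuous.div_const _).measurable.ennreal_ofReal
    (Eventually.of_forall fun _ => ENNReal.ofReal_lt_top), ← integral_div]
  refine integral_congr_ae (Eventually.of_forall fun x => ?_)
  simp only [ENNReal.toReal_ofReal (density_nonneg x), smul_eq_mul]
  ring

theorem isProbabilityMeasure_normalizedDensity (hpos : ∀ x, 0 < h x) :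
    IsProbabilityMeasure (normalizedDensity h μ) := by
  have integral_h_pos : 0 < ∫ x, h x ∂μ := integral_pos_of_pos hpos
  constructor
  rw [normalizedDensity, withDensity_apply _ MeasurableSet.univ, Measure.restrict_univ,
    ← ofReal_integral_eq_lintegral_ofReal
      (integrable_of_compactSpace (h.continuous.div_const _))
      (Eventually.of_forall fun x => div_nonneg (hpos x).le integral_h_pos.le),
    integral_div, div_self integral_h_pos.ne', ENNReal.ofReal_one]

end NormalizedDensity

namespace Subshift

variable {ι : Type*} [Fintype ι] {A : Matrix ι ι ℕ}

section Norm

theorem norm_transfer_le {f : Subshift A → ℝ} {u : Subshift A → ℂ} {h : Subshift A → ℝ}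
    (hu : ∀ x, ‖u x‖ ≤ h x) (x : Subshift A) : ‖transfer f u x‖ ≤ transfer f h x := by
  refine norm_sum_le_of_le _ fun i _ => ?_
  split_ifs with hi
  · rw [norm_smul, Real.norm_eq_abs, Real.abs_exp]
    exact mul_le_mul_of_nonneg_left (hu _) (Real.exp_pos _).le
  · exact norm_zero.le

theorem transfer_ofReal (f w : Subshift A → ℝ) (x : Subshift A) :
    transfer f (fun y => (w y : ℂ)) x = ((transfer f w x : ℝ) : ℂ) := by
  simp only [transfer, Complex.ofReal_sum]
  refine Finset.sum_congr rfl fun i _ => ?_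
  split_ifs with hi
  · rw [Complex.real_smul, smul_eq_mul, Complex.ofReal_mul]
  · exact Complex.ofReal_zero.symm

end Norm

variable [TopologicalSpace ι] [DiscreteTopology ι] {f h : C(Subshift A, ℝ)}

section Pressure

theorem norm_transferCLM_pow_apply_le (hfix : transferPos f h = h) {w : C(Subshift A, ℂ)}
    (hw : ∀ x, ‖w x‖ ≤ h x) (n : ℕ) (x : Subshift A) : ‖(transferCLM f ^ n) w x‖ ≤ h x := by
  induction n generalizing x with
  | zero => exact hw x
  | succ n ih =>
    calc ‖(transferCLM f ^ (n + 1)) w x‖ = ‖transfer f ((transferCLM f ^ n) w) x‖ := by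
          rw [pow_succ']; rfl
      _ ≤ transfer f h x := norm_transfer_le ih x
      _ = h x := DFunLike.congr_fun hfix x

variable [Nonempty (Subshift A)]

theorem exists_norm_transferCLM_pow_le (hpos : ∀ x, 0 < h x) (hfix : transferPos f h = h) :
    ∃ K, ∀ n, ‖transferCLM f ^ n‖ ≤ K := by
  obtain ⟨x₀, -, hx₀⟩ := isCompact_univ.exists_isMinOn Set.univ_nonempty h.continuous.continuousOn
  have div_nonneg' {a : ℝ} (ha : 0 ≤ a) : 0 ≤ a / h x₀ := div_nonneg ha (hpos x₀).le
  refine ⟨‖h‖ / h x₀, fun n => ContinuousLinearMap.opNorm_le_bound _ (div_nonneg' (norm_nonneg h))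
    fun w => (ContinuousMap.norm_le _
      (mul_nonneg (div_nonneg' (norm_nonneg h)) (norm_nonneg w))).2 fun x => ?_⟩
  have norm_w_le (y) : ‖w y‖ ≤ ((‖w‖ / h x₀) • h) y :=
    calc ‖w y‖ ≤ ‖w‖ := w.norm_coe_le_norm y
      _ = ‖w‖ / h x₀ * h x₀ := (div_mul_cancel₀ _ (hpos x₀).ne').symm
      _ ≤ ‖w‖ / h x₀ * h y :=
        mul_le_mul_of_nonneg_left (hx₀ (Set.mem_univ y)) (div_nonneg' (norm_nonneg w))
  calc ‖(transferCLM f ^ n) w x‖ ≤ ‖w‖ / h x₀ * h x :=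
        norm_transferCLM_pow_apply_le (by rw [map_smul, hfix]) norm_w_le n x
    _ ≤ ‖w‖ / h x₀ * ‖h‖ := mul_le_mul_of_nonneg_left
        ((le_abs_self _).trans (h.norm_coe_le_norm x)) (div_nonneg' (norm_nonneg w))
    _ = ‖h‖ / h x₀ * ‖w‖ := by ring

theorem pressure_eq_zero (hpos : ∀ x, 0 < h x) (hfix : transferPos f h = h) : pressure f = 0 := by
  let w : C(Subshift A, ℂ) := ⟨fun x => (h x : ℂ), Complex.continuous_ofReal.comp h.continuous⟩
  have w_ne : w ≠ 0 := fun hw =>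
    (hpos (Classical.arbitrary _)).ne' (Complex.ofReal_eq_zero.1 (DFunLike.congr_fun hw _))
  have transfer_w : transferCLM f w = w := ContinuousMap.ext fun x =>
    (transfer_ofReal f h x).trans (congrArg _ (DFunLike.congr_fun hfix x))
  obtain ⟨K, hK⟩ := exists_norm_transferCLM_pow_le hpos hfix
  rw [pressure, le_antisymm (spectralRadius_le_one_of_norm_pow_le hK)
    (one_le_spectralRadius_of_apply_eq_self w_ne transfer_w), ENNReal.toReal_one, Real.log_one]

end Pressure

section EquilibriumState

/-- `μ` is a probability measure with `L_f^* μ = μ`. -/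
structure IsConformalMeasure (f : C(Subshift A, ℝ)) (μ : Measure (Subshift A)) : Prop where
  isProbabilityMeasure : IsProbabilityMeasure μ
  integral_transfer : ∀ φ : C(Subshift A, ℝ), ∫ x, transfer f φ x ∂μ = ∫ x, φ x ∂μ

variable {μ : Measure (Subshift A)}

theorem exists_isConformalMeasure [Nonempty (Subshift A)] (hpos : ∀ x, 0 < h x)
    (hfix : transferPos f h = h) : ∃ μ, IsConformalMeasure f μ :=
  let ⟨μ, hμ, integral_transfer⟩ := exists_isProbabilityMeasure_integral_map_eq hpos hfix
  ⟨μ, hμ, integral_transfer⟩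

theorem isEquilibriumState_iff [Nonempty (Subshift A)] (hA : IsTransitive A)
    (hpos : ∀ x, 0 < h x) (hfix : transferPos f h = h) {m : Measure (Subshift A)} :
    IsEquilibriumState f m ↔ ∃ μ, IsConformalMeasure f μ ∧ m = normalizedDensity h μ := by
  have pressure_zero : pressure f = 0 := pressure_eq_zero hpos hfix
  simp only [IsEquilibriumState, pressure_zero, Real.exp_zero, one_mul, true_and]
  constructor
  · rintro ⟨v, μ, v_pos, transfer_v, hμ, integral_transfer, rfl⟩
    obtain ⟨c, rfl⟩ := exists_eq_smul_of_transferPos_eq hA hpos hfix (ContinuousMap.ext transfer_v)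
    have c_ne : c ≠ 0 := left_ne_zero_of_mul (v_pos (Classical.arbitrary _)).ne'
    exact ⟨μ, ⟨hμ, integral_transfer⟩, normalizedDensity_smul c_ne⟩
  · rintro ⟨μ, hμ, rfl⟩
    exact ⟨h, μ, hpos, DFunLike.congr_fun hfix, hμ.isProbabilityMeasure, hμ.integral_transfer, rfl⟩

theorem integral_comp_shift_mul_normalizedDensity (hμ : IsConformalMeasure f μ)
    (hpos : ∀ x, 0 < h x) {u g φ : C(Subshift A, ℝ)} (hug : transferPos f (u * h) = g * h) :
    ∫ x, φ (shift x) * u x ∂normalizedDensity h μ = ∫ x, φ x * g x ∂normalizedDensity h μ := by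
  have := hμ.isProbabilityMeasure
  rw [integral_normalizedDensity hpos, integral_normalizedDensity hpos]
  have transfer_eq (x) : transfer f (fun y => φ (shift y) * u y * h y) x = φ x * g x * h x := by
    simp only [mul_assoc]
    exact (transfer_mul_comp_shift f φ (u * h) x).trans
      (congrArg (φ x * ·) (DFunLike.congr_fun hug x))
  have integral_transfer := hμ.integral_transfer
    ⟨fun y => φ (shift y) * u y * h y,
      ((φ.continuous.comp continuous_shift).mul u.continuous).mul h.continuous⟩
  simp only [ContinuousMap.coe_mk, transfer_eq] at integral_transfer
  rw [integral_transfer]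

theorem integral_comp_shift_normalizedDensity (hμ : IsConformalMeasure f μ)
    (hpos : ∀ x, 0 < h x) (hfix : transferPos f h = h) (φ : C(Subshift A, ℝ)) :
    ∫ x, φ (shift x) ∂normalizedDensity h μ = ∫ x, φ x ∂normalizedDensity h μ := by
  have adjoint := integral_comp_shift_mul_normalizedDensity (u := 1) (g := 1) (φ := φ) hμ hpos
    (by rwa [one_mul])
  simpa only [ContinuousMap.one_apply, mul_one] using adjoint

end EquilibriumState

end Subshift

/-! ### Variance of reverse martingale differences -/

section SecondMoments

theorem abs_sq_sub_sq_le {r : ℝ} (hr : 0 < r) (a b : ℝ) :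
    |a ^ 2 - b ^ 2| ≤ b ^ 2 / r + (r + 1) * (a - b) ^ 2 := by
  have cross_le (c : ℝ) : 2 * (b * c) ≤ b ^ 2 / r + r * c ^ 2 := by
    have : b ^ 2 / r + r * c ^ 2 - 2 * (b * c) = (b - r * c) ^ 2 / r := by
      field_simp
      ring
    linarith [div_nonneg (sq_nonneg (b - r * c)) hr.le]
  rw [abs_le]
  constructor <;> nlinarith [cross_le (a - b), cross_le (b - a), sq_nonneg (a - b)]

variable {X : Type*} [MeasurableSpace X] {m : Measure X} [IsProbabilityMeasure m]

theorem abs_integral_sq_sub_le {S D : X → ℝ} {C : ℝ} (hS : Integrable (fun x => S x ^ 2) m)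
    (hD : Integrable (fun x => D x ^ 2) m) (hSD : ∀ x, |S x - D x| ≤ C) {r : ℝ} (hr : 0 < r) :
    |∫ x, S x ^ 2 ∂m - ∫ x, D x ^ 2 ∂m| ≤ (∫ x, D x ^ 2 ∂m) / r + (r + 1) * C ^ 2 := by
  rw [← integral_sub hS hD]
  calc |∫ x, (S x ^ 2 - D x ^ 2) ∂m| ≤ ∫ x, |S x ^ 2 - D x ^ 2| ∂m := abs_integral_le_integral_abs
    _ ≤ ∫ x, (D x ^ 2 / r + (r + 1) * C ^ 2) ∂m := by
      refine integral_mono (hS.sub hD).abs ((hD.div_const r).add (integrable_const _)) fun x => ?_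
      refine (abs_sq_sub_sq_le hr (S x) (D x)).trans ?_
      gcongr _ + _ * ?_
      exact sq_le_sq.2 ((hSD x).trans (le_abs_self C))
    _ = (∫ x, D x ^ 2 ∂m) / r + (r + 1) * C ^ 2 := by
      rw [integral_add (hD.div_const r) (integrable_const _), integral_div, integral_const,
        probReal_univ, one_smul]

theorem tendsto_integral_sq_of_abs_sub_le {S D : ℕ → X → ℝ} {C V : ℝ}
    (hS : ∀ n, Integrable (fun x => S n x ^ 2) m) (hD : ∀ n, Integrable (fun x => D n x ^ 2) m)
    (hSD : ∀ n x, |S n x - D n x| ≤ C) (hV : ∀ n, ∫ x, D n x ^ 2 ∂m = n * V) :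
    Tendsto (fun n : ℕ => (1 / (n : ℝ)) * ∫ x, S n x ^ 2 ∂m) atTop (𝓝 V) := by
  have inv_sqrt_tendsto : Tendsto (fun n : ℕ => (√(n : ℝ))⁻¹) atTop (𝓝 0) :=
    tendsto_inv_atTop_zero.comp (Real.tendsto_sqrt_atTop.comp tendsto_natCast_atTop_atTop)
  have bound_tendsto :
      Tendsto (fun n : ℕ => (V + C ^ 2) * (√(n : ℝ))⁻¹ + C ^ 2 * (√(n : ℝ))⁻¹ ^ 2) atTop (𝓝 0) := by
    simpa using (inv_sqrt_tendsto.const_mul (V + C ^ 2)).add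
      ((inv_sqrt_tendsto.pow 2).const_mul (C ^ 2))
  refine tendsto_iff_norm_sub_tendsto_zero.2
    (squeeze_zero' (Eventually.of_forall fun _ => norm_nonneg _) ?_ bound_tendsto)
  filter_upwards [eventually_gt_atTop 0] with n hn
  have sqrt_pos : 0 < √(n : ℝ) := Real.sqrt_pos.2 (Nat.cast_pos.2 hn)
  have sq_sqrt : (n : ℝ) = √(n : ℝ) ^ 2 := (Real.sq_sqrt n.cast_nonneg).symm
  have moment_close := abs_integral_sq_sub_le (hS n) (hD n) (hSD n) sqrt_pos
  rw [hV] at moment_close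
  calc ‖1 / (n : ℝ) * ∫ x, S n x ^ 2 ∂m - V‖
      = 1 / (n : ℝ) * |∫ x, S n x ^ 2 ∂m - n * V| := by
        rw [Real.norm_eq_abs, ← abs_of_pos (one_div_pos.2 (Nat.cast_pos (α := ℝ).2 hn)), ← abs_mul,
          abs_of_pos (one_div_pos.2 (Nat.cast_pos (α := ℝ).2 hn)), mul_sub, ← mul_assoc,
          one_div_mul_cancel (Nat.cast_pos.2 hn).ne', one_mul]
    _ ≤ 1 / (n : ℝ) * (n * V / √(n : ℝ) + (√(n : ℝ) + 1) * C ^ 2) := by gcongr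
    _ = (V + C ^ 2) * (√(n : ℝ))⁻¹ + C ^ 2 * (√(n : ℝ))⁻¹ ^ 2 := by
        rw [sq_sqrt, Real.sqrt_sq sqrt_pos.le]
        field_simp
        ring

end SecondMoments

section Gordin

variable {X : Type*} [TopologicalSpace X] {σ : X → X} {u g : C(X, ℝ)}

theorem continuous_birkhoffSum {φ : X → ℝ} (hσ : Continuous σ) (hφ : Continuous φ) (n : ℕ) :
    Continuous (birkhoffSum σ φ n) :=
  continuous_finsetSum _ fun k _ => hφ.comp (hσ.iterate k)

variable [CompactSpace X]

theorem abs_birkhoffSum_sub_birkhoffSum_sub_comp_le (n : ℕ) (x : X) :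
    |birkhoffSum σ (u - g) n x - birkhoffSum σ (fun y => u y - g (σ y)) n x| ≤ 2 * ‖g‖ := by
  have telescope : birkhoffSum σ (u - g) n x - birkhoffSum σ (fun y => u y - g (σ y)) n x =
      g (σ^[n] x) - g x := by
    rw [← birkhoffSum_apply_sub_birkhoffSum]
    simp only [birkhoffSum, ← Finset.sum_sub_distrib, ContinuousMap.sub_apply,
      ← Function.iterate_succ_apply,
      Function.iterate_succ_apply']
    exact Finset.sum_congr rfl fun k _ => by ring
  rw [telescope, two_mul]
  exact (abs_sub _ _).trans (add_le_add (g.norm_coe_le_norm _) (g.norm_coe_le_norm x))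

variable [MeasurableSpace X] [BorelSpace X] {m : Measure X} [IsProbabilityMeasure m]

theorem integral_sub_comp_mul_comp_eq_zero (hσ : Continuous σ)
    (hinv : ∀ φ : C(X, ℝ), ∫ x, φ (σ x) ∂m = ∫ x, φ x ∂m)
    (hadj : ∀ φ : C(X, ℝ), ∫ x, φ (σ x) * u x ∂m = ∫ x, φ x * g x ∂m) {ψ : X → ℝ}
    (hψ : Continuous ψ) : ∫ x, (u x - g (σ x)) * ψ (σ x) ∂m = 0 := by
  have integral_u := hadj ⟨ψ, hψ⟩
  have integral_g := hinv (⟨ψ, hψ⟩ * g)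
  simp only [ContinuousMap.mul_apply, ContinuousMap.coe_mk] at integral_u integral_g
  have expand (x) : (u x - g (σ x)) * ψ (σ x) = ψ (σ x) * u x - ψ (σ x) * g (σ x) := by ring
  simp only [expand]
  rw [integral_sub (integrable_of_compactSpace (by fun_prop))
    (integrable_of_compactSpace (by fun_prop)), integral_u, integral_g, sub_self]

theorem integral_sub_comp_sq (hσ : Continuous σ)
    (hinv : ∀ φ : C(X, ℝ), ∫ x, φ (σ x) ∂m = ∫ x, φ x ∂m)
    (hadj : ∀ φ : C(X, ℝ), ∫ x, φ (σ x) * u x ∂m = ∫ x, φ x * g x ∂m) :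
    ∫ x, (u x - g (σ x)) ^ 2 ∂m = ∫ x, (u x ^ 2 - g x ^ 2) ∂m := by
  have orthogonal := integral_sub_comp_mul_comp_eq_zero hσ hinv hadj g.continuous
  have integral_sq := hinv (g ^ 2)
  simp only [ContinuousMap.pow_apply] at integral_sq
  have expand (x) : (u x - g (σ x)) ^ 2 =
      u x ^ 2 - 2 * ((u x - g (σ x)) * g (σ x)) - g (σ x) ^ 2 := by ring
  simp only [expand]
  rw [integral_sub (integrable_of_compactSpace (by fun_prop))
      (integrable_of_compactSpace (by fun_prop)),
    integral_sub (integrable_of_compactSpace (by fun_prop))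
      (integrable_of_compactSpace (by fun_prop)),
    integral_const_mul, orthogonal, mul_zero, sub_zero, integral_sq,
    ← integral_sub (integrable_of_compactSpace (by fun_prop))
      (integrable_of_compactSpace (by fun_prop))]

theorem integral_birkhoffSum_sub_comp_sq (hσ : Continuous σ)
    (hinv : ∀ φ : C(X, ℝ), ∫ x, φ (σ x) ∂m = ∫ x, φ x ∂m)
    (hadj : ∀ φ : C(X, ℝ), ∫ x, φ (σ x) * u x ∂m = ∫ x, φ x * g x ∂m) (n : ℕ) :
    ∫ x, birkhoffSum σ (fun y => u y - g (σ y)) n x ^ 2 ∂m =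
      n * ∫ x, (u x ^ 2 - g x ^ 2) ∂m := by
  induction n with
  | zero => simp
  | succ n ih =>
    set D := birkhoffSum σ (fun y => u y - g (σ y)) n
    have continuous_D : Continuous D := continuous_birkhoffSum hσ (by fun_prop) n
    have orthogonal := integral_sub_comp_mul_comp_eq_zero hσ hinv hadj continuous_D
    have integral_D_sq := hinv (⟨D, continuous_D⟩ ^ 2)
    simp only [ContinuousMap.pow_apply, ContinuousMap.coe_mk] at integral_D_sq
    have expand (x) : birkhoffSum σ (fun y => u y - g (σ y)) (n + 1) x ^ 2 =
        (u x - g (σ x)) ^ 2 + 2 * ((u x - g (σ x)) * D (σ x)) + D (σ x) ^ 2 := by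
      rw [birkhoffSum_succ']
      ring
    simp only [expand]
    rw [integral_add (integrable_of_compactSpace (by fun_prop))
        (integrable_of_compactSpace (by fun_prop)),
      integral_add (integrable_of_compactSpace (by fun_prop))
        (integrable_of_compactSpace (by fun_prop)),
      integral_const_mul, orthogonal, integral_D_sq, ih, integral_sub_comp_sq hσ hinv hadj]
    push_cast
    ring

theorem tendsto_integral_birkhoffSum_sq (hσ : Continuous σ)
    (hinv : ∀ φ : C(X, ℝ), ∫ x, φ (σ x) ∂m = ∫ x, φ x ∂m)
    (hadj : ∀ φ : C(X, ℝ), ∫ x, φ (σ x) * u x ∂m = ∫ x, φ x * g x ∂m) :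
    Tendsto (fun n : ℕ => (1 / (n : ℝ)) * ∫ x, birkhoffSum σ (u - g) n x ^ 2 ∂m) atTop
      (𝓝 (∫ x, (u x ^ 2 - g x ^ 2) ∂m)) :=
  tendsto_integral_sq_of_abs_sub_le
    (fun n => integrable_of_compactSpace
      ((continuous_birkhoffSum hσ (u - g).continuous n).pow 2))
    (fun n => integrable_of_compactSpace
      ((continuous_birkhoffSum hσ (by fun_prop) n).pow 2))
    abs_birkhoffSum_sub_birkhoffSum_sub_comp_le
    (integral_birkhoffSum_sub_comp_sq hσ hinv hadj)

end Gordin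

namespace Subshift

variable {ι : Type*} [Fintype ι] [TopologicalSpace ι] [DiscreteTopology ι] {A : Matrix ι ι ℕ}
  {f h : C(Subshift A, ℝ)} {μ : Measure (Subshift A)}

theorem hasVariance_normalizedDensity (hμ : IsConformalMeasure f μ) (hpos : ∀ x, 0 < h x)
    (hfix : transferPos f h = h) {u g : C(Subshift A, ℝ)}
    (hug : transferPos f (u * h) = g * h) :
    HasVariance (u - g) (normalizedDensity h μ)
      (∫ x, (u x ^ 2 - g x ^ 2) ∂normalizedDensity h μ) := by
  have := hμ.isProbabilityMeasure
  have := isProbabilityMeasure_normalizedDensity (μ := μ) hpos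
  have adjoint (φ : C(Subshift A, ℝ)) :=
    integral_comp_shift_mul_normalizedDensity (φ := φ) hμ hpos hug
  have mean_zero : ∫ x, (u - g) x ∂normalizedDensity h μ = 0 := by
    have integral_eq := adjoint 1
    simp only [ContinuousMap.one_apply, one_mul] at integral_eq
    simp only [ContinuousMap.sub_apply]
    rw [integral_sub (integrable_of_compactSpace u.continuous)
      (integrable_of_compactSpace g.continuous), integral_eq, sub_self]
  simp only [HasVariance, mean_zero, mul_zero, sub_zero]
  exact tendsto_integral_birkhoffSum_sq continuous_shift
    (integral_comp_shift_normalizedDensity hμ hpos hfix) adjoint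

end Subshift

/-! ### Potentials that depend on the zeroth letter -/

namespace Subshift

variable {ι : Type*} {A : Matrix ι ι ℕ}

/-- The matrix with the entries `A(i, j) e^{φ(i)}`, which represents the transfer operator of the
potential `φ(x₀)` on the functions of the zeroth letter. -/
noncomputable def transferMat (A : Matrix ι ι ℕ) (φ : ι → ℝ) : Matrix ι ι ℝ := fun i j =>
  if A i j = 1 then Real.exp (φ i) else 0

theorem transferMat_nonneg (φ : ι → ℝ) (i j : ι) : 0 ≤ transferMat A φ i j := by
  rw [transferMat]
  split_ifs
  exacts [(Real.exp_pos _).le, le_rfl]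

theorem transferMat_pos {φ : ι → ℝ} {i j : ι} (h : A i j = 1) : 0 < transferMat A φ i j := by
  rw [transferMat, if_pos h]
  exact Real.exp_pos _

theorem IsTransitive.reflTransGen_transferMat (hA : IsTransitive A) (φ : ι → ℝ) (i j : ι) :
    Relation.ReflTransGen (fun i j => 0 < transferMat A φ i j) i j :=
  Relation.ReflTransGen.mono (fun _ _ => transferMat_pos) _ _ (hA i j)

section LetterFunctions

variable [TopologicalSpace ι] [DiscreteTopology ι]

/-- A function of the letters, as a function on the subshift that depends only on the zeroth
letter. -/
def letterFun (A : Matrix ι ι ℕ) (φ : ι → ℝ) : C(Subshift A, ℝ) :=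
  ⟨fun x => φ (coord 0 x), continuous_of_discreteTopology.comp (continuous_coord 0)⟩

@[simp] theorem letterFun_apply (φ : ι → ℝ) (x : Subshift A) :
    letterFun A φ x = φ (coord 0 x) := rfl

variable [Fintype ι]

theorem transferPos_letterFun (φ w : ι → ℝ) :
    transferPos (letterFun A φ) (letterFun A w) =
      letterFun A (Matrix.vecMul w (transferMat A φ)) := by
  ext x
  refine Finset.sum_congr rfl fun i _ => ?_
  simp only [transferMat]
  split_ifs
  · exact mul_comm _ _
  · exact (mul_zero _).symm

theorem transfer_indicator_cylinder (φ : ι → ℝ) (s : ℕ → ι) (n : ℕ) (x : Subshift A) :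
    transfer (letterFun A φ) ((cylinder s (n + 2)).indicator fun _ => (1 : ℝ)) x =
      transferMat A φ (s 0) (s 1) *
        (cylinder (fun k => s (k + 1)) (n + 1)).indicator (fun _ => 1) x := by
  rw [transfer, Finset.sum_eq_single (s 0)]
  · by_cases hx : x ∈ cylinder (fun k => s (k + 1)) (n + 1)
    · have coord_eq : coord 0 x = s 1 := hx 0 n.succ_pos
      rw [Set.indicator_of_mem hx, mul_one, transferMat, ← coord_eq]
      split_ifs with hi
      · rw [Set.indicator_of_mem ((cons_mem_cylinder hi).2 ⟨rfl, hx⟩), smul_eq_mul, mul_one]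
        rfl
      · rfl
    · rw [Set.indicator_of_notMem hx, mul_zero]
      split_ifs with hi
      · rw [Set.indicator_of_notMem fun h => hx ((cons_mem_cylinder hi).1 h).2, smul_zero]
      · rfl
  · intro i _ hne
    split_ifs with hi
    · rw [Set.indicator_of_notMem fun h => hne ((cons_mem_cylinder hi).1 h).1, smul_zero]
    · rfl
  · exact fun h => absurd (Finset.mem_univ _) h

end LetterFunctions

section LetterMass

/-- The distribution of the zeroth letter under `μ`. -/
noncomputable def letterMass [TopologicalSpace ι] (μ : Measure (Subshift A)) (i : ι) : ℝ :=
  μ.real (coord 0 ⁻¹' {i})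

variable [Fintype ι] [TopologicalSpace ι] [DiscreteTopology ι] {μ : Measure (Subshift A)}
  {φ : ι → ℝ}

theorem integral_letterFun [IsFiniteMeasure μ] (w : ι → ℝ) :
    ∫ x, w (coord 0 x) ∂μ = w ⬝ᵥ letterMass μ := by
  let _ : MeasurableSpace ι := borel ι
  have : BorelSpace ι := ⟨rfl⟩
  have measurable_coord : Measurable (coord 0 : Subshift A → ι) := (continuous_coord 0).measurable
  rw [← integral_map (f := w) measurable_coord.aemeasurable
    (measurable_of_countable w).aestronglyMeasurable, integral_fintype (.of_finite ..)]
  refine Finset.sum_congr rfl fun i _ => ?_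
  rw [map_measureReal_apply measurable_coord (measurableSet_singleton i), smul_eq_mul, mul_comm]
  rfl

theorem IsConformalMeasure.mulVec_letterMass (hμ : IsConformalMeasure (letterFun A φ) μ) :
    (transferMat A φ).mulVec (letterMass μ) = letterMass μ := by
  have := hμ.isProbabilityMeasure
  refine dotProduct_eq _ _ fun w => ?_
  rw [dotProduct_comm, Matrix.dotProduct_mulVec, ← integral_letterFun, dotProduct_comm,
    ← integral_letterFun]
  refine Eq.trans (integral_congr_ae (Eventually.of_forall fun x => ?_))
    (hμ.integral_transfer (letterFun A w))
  exact (DFunLike.congr_fun (transferPos_letterFun φ w) x).symm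

theorem IsConformalMeasure.measureReal_cylinder_add_two
    (hμ : IsConformalMeasure (letterFun A φ) μ) (s : ℕ → ι) (n : ℕ) :
    μ.real (cylinder s (n + 2)) =
      transferMat A φ (s 0) (s 1) * μ.real (cylinder (fun k => s (k + 1)) (n + 1)) := by
  have := hμ.isProbabilityMeasure
  have integral_indicator_cylinder (t : ℕ → ι) (k : ℕ) :
      ∫ x, (cylinder t k).indicator (fun _ => (1 : ℝ)) x ∂μ = μ.real (cylinder t k) := by
    rw [integral_indicator_const _ (isClopen_cylinder t k).isOpen.measurableSet, smul_eq_mul,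
      mul_one]
  have integral_transfer := hμ.integral_transfer ⟨(cylinder s (n + 2)).indicator fun _ => 1,
    (isClopen_cylinder s (n + 2)).continuous_indicator continuous_const⟩
  simp only [ContinuousMap.coe_mk, transfer_indicator_cylinder] at integral_transfer
  rw [← integral_indicator_cylinder, ← integral_indicator_cylinder, ← integral_transfer,
    integral_const_mul]

end LetterMass

section PerronPair

variable [Fintype ι]

/-- The potential `φ(x₀)` is normalised to have pressure zero: `h` and `ρ` are positive left and
right eigenvectors, for the eigenvalue `1`, of the transfer matrix of a transitive subshift. -/
structure IsPerronPair (A : Matrix ι ι ℕ) (φ h ρ : ι → ℝ) : Prop where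
  isTransitive : IsTransitive A
  left_pos : ∀ i, 0 < h i
  vecMul_left : Matrix.vecMul h (transferMat A φ) = h
  right_pos : ∀ i, 0 < ρ i
  mulVec_right : (transferMat A φ).mulVec ρ = ρ

namespace IsPerronPair

variable {φ h ρ : ι → ℝ} (H : IsPerronPair A φ h ρ)
include H

theorem exists_eq_smul_right {w : ι → ℝ} (hw : (transferMat A φ).mulVec w = w) :
    ∃ c : ℝ, w = c • ρ :=
  exists_eq_smul_of_mulVec_eq_self (transferMat_nonneg φ)
    (H.isTransitive.reflTransGen_transferMat φ) H.right_pos H.mulVec_right hw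

theorem exists_eq_smul_left {w : ι → ℝ} (hw : Matrix.vecMul w (transferMat A φ) = w) :
    ∃ c : ℝ, w = c • h := by
  refine exists_eq_smul_of_mulVec_eq_self (B := (transferMat A φ).transpose)
    (fun i j => transferMat_nonneg φ j i) (fun i j => ?_) H.left_pos ?_ ?_
  · exact (H.isTransitive.reflTransGen_transferMat φ j i).swap
  · rw [Matrix.mulVec_transpose, H.vecMul_left]
  · rw [Matrix.mulVec_transpose, hw]

variable [TopologicalSpace ι] [DiscreteTopology ι] {μ ν : Measure (Subshift A)}

theorem transferPos_left : transferPos (letterFun A φ) (letterFun A h) = letterFun A h := by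
  rw [transferPos_letterFun, H.vecMul_left]

theorem letterFun_left_pos (x : Subshift A) : 0 < letterFun A h x := H.left_pos _

theorem letterMass_eq (hμ : IsConformalMeasure (letterFun A φ) μ) :
    letterMass μ = (∑ i, ρ i)⁻¹ • ρ := by
  have := hμ.isProbabilityMeasure
  obtain ⟨c, hc⟩ := H.exists_eq_smul_right hμ.mulVec_letterMass
  have c_mul_sum : c * ∑ i, ρ i = 1 := calc
    c * ∑ i, ρ i = 1 ⬝ᵥ letterMass μ := by rw [one_dotProduct, hc, Finset.mul_sum]; rfl
    _ = ∫ _, 1 ∂μ := (integral_letterFun 1).symm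
    _ = 1 := by rw [integral_const, probReal_univ, one_smul]
  rw [hc, eq_inv_of_mul_eq_one_left c_mul_sum]

theorem eq_of_isConformalMeasure (hμ : IsConformalMeasure (letterFun A φ) μ)
    (hν : IsConformalMeasure (letterFun A φ) ν) : μ = ν := by
  have := hμ.isProbabilityMeasure
  have := hν.isProbabilityMeasure
  have real_cylinder_eq (n : ℕ) (s : ℕ → ι) :
      μ.real (cylinder s (n + 1)) = ν.real (cylinder s (n + 1)) := by
    induction n generalizing s with
    | zero =>
      have cylinder_one : (cylinder s 1 : Set (Subshift A)) = coord 0 ⁻¹' {s 0} := by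
        ext x
        simp [cylinder]
      rw [cylinder_one]
      exact congrFun ((H.letterMass_eq hμ).trans (H.letterMass_eq hν).symm) (s 0)
    | succ n ih => rw [hμ.measureReal_cylinder_add_two, hν.measureReal_cylinder_add_two, ih]
  refine measure_ext_cylinder fun s n => ?_
  cases n with
  | zero =>
    have cylinder_zero : (cylinder s 0 : Set (Subshift A)) = Set.univ :=
      Set.eq_univ_of_forall fun x k hk => absurd hk k.not_lt_zero
    rw [cylinder_zero, measure_univ, measure_univ]
  | succ n => exact (measureReal_eq_measureReal_iff).1 (real_cylinder_eq n s)

theorem isEquilibriumState_iff [Nonempty (Subshift A)] {m : Measure (Subshift A)} :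
    IsEquilibriumState (letterFun A φ) m ↔
      ∃ μ, IsConformalMeasure (letterFun A φ) μ ∧ m = normalizedDensity (letterFun A h) μ :=
  Subshift.isEquilibriumState_iff H.isTransitive H.letterFun_left_pos H.transferPos_left

theorem existsUnique_isEquilibriumState [Nonempty (Subshift A)] :
    ∃! m, IsEquilibriumState (letterFun A φ) m := by
  obtain ⟨μ, hμ⟩ := exists_isConformalMeasure H.letterFun_left_pos H.transferPos_left
  refine ⟨_, H.isEquilibriumState_iff.2 ⟨μ, hμ, rfl⟩, fun m hm => ?_⟩
  obtain ⟨ν, hν, rfl⟩ := H.isEquilibriumState_iff.1 hm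
  rw [H.eq_of_isConformalMeasure hν hμ]

theorem integral_letterFun_equilibrium [Nonempty (Subshift A)] {m : Measure (Subshift A)}
    (hm : IsEquilibriumState (letterFun A φ) m) (w : ι → ℝ) :
    ∫ x, w (coord 0 x) ∂m = (∑ i, w i * (h i * ρ i)) / ∑ i, h i * ρ i := by
  obtain ⟨μ, hμ, rfl⟩ := H.isEquilibriumState_iff.1 hm
  have := hμ.isProbabilityMeasure
  obtain ⟨x⟩ := ‹Nonempty (Subshift A)›
  have sum_right_pos : 0 < ∑ i, ρ i :=
    Finset.sum_pos (fun i _ => H.right_pos i) ⟨coord 0 x, Finset.mem_univ _⟩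
  have integral_eq (v : ι → ℝ) : ∫ x, v (coord 0 x) ∂μ = (∑ i, ρ i)⁻¹ * ∑ i, v i * ρ i := by
    rw [integral_letterFun, H.letterMass_eq hμ, dotProduct_smul, smul_eq_mul]
    rfl
  rw [integral_normalizedDensity H.letterFun_left_pos]
  simp only [letterFun_apply]
  rw [integral_eq h, integral_eq fun i => w i * h i,
    mul_div_mul_left _ _ (inv_ne_zero sum_right_pos.ne')]
  simp only [mul_assoc]

theorem hasVariance_letterFun_sub [Nonempty (Subshift A)] {m : Measure (Subshift A)}
    (hm : IsEquilibriumState (letterFun A φ) m) {u g : ι → ℝ}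
    (hug : Matrix.vecMul (u * h) (transferMat A φ) = g * h) :
    HasVariance (letterFun A (u - g)) m
      ((∑ i, (u i ^ 2 - g i ^ 2) * (h i * ρ i)) / ∑ i, h i * ρ i) := by
  rw [← H.integral_letterFun_equilibrium hm]
  obtain ⟨μ, hμ, rfl⟩ := H.isEquilibriumState_iff.1 hm
  refine hasVariance_normalizedDensity hμ H.letterFun_left_pos H.transferPos_left
    (u := letterFun A u) (g := letterFun A g) ?_
  exact (transferPos_letterFun φ (u * h)).trans (congrArg (letterFun A) hug)

end IsPerronPair

end PerronPair

end Subshift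

/-! ### Counting paths -/

theorem exists_pos_forall_le {ι : Type*} [Finite ι] {ℓ : ι → ℝ} (hℓ : ∀ i, 0 < ℓ i) :
    ∃ a > 0, ∀ i, a ≤ ℓ i := by
  rcases isEmpty_or_nonempty ι with h | h
  · exact ⟨1, one_pos, h.elim⟩
  · obtain ⟨i, hi⟩ := Finite.exists_min ℓ
    exact ⟨ℓ i, hℓ i, hi⟩

theorem renewal_induction {ι : Type*} [Finite ι] {ℓ : ι → ℝ} (hℓ : ∀ i, 0 < ℓ i) {b t₀ : ℝ}
    (hb : ∀ i, ℓ i ≤ b) {P : ι → ℝ → Prop}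
    (base : ∀ i T, t₀ ≤ T → T ≤ t₀ + b → P i T)
    (step : ∀ i T, t₀ + b ≤ T → (∀ k, P k (T - ℓ i)) → P i T) (i : ι) (T : ℝ) (hT : t₀ ≤ T) :
    P i T := by
  obtain ⟨a, a_pos, a_le⟩ := exists_pos_forall_le hℓ
  obtain ⟨n, hn⟩ := Archimedean.arch (T - (t₀ + b)) a_pos
  rw [sub_le_iff_le_add'] at hn
  induction n generalizing i T with
  | zero => exact base i T hT (by simpa using hn)
  | succ n ih =>
    rcases le_total T (t₀ + b) with h | h
    · exact base i T hT h
    · refine step i T h fun k => ih k _ (by linarith [hb i]) ?_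
      rw [succ_nsmul] at hn
      linarith [a_le i]

theorem tendsto_one_div_mul_log_of_le {N : ℝ → ℝ} {c C δ T₀ : ℝ} (hc : 0 < c)
    (hN : ∀ T ≥ T₀, c * Real.exp (δ * T) ≤ N T) (hN' : ∀ T ≥ T₀, N T ≤ C * Real.exp (δ * T)) :
    Tendsto (fun T => (1 / T) * Real.log (N T)) atTop (𝓝 δ) := by
  have hC : 0 < C := hc.trans_le <| le_of_mul_le_mul_right
    ((hN T₀ le_rfl).trans (hN' T₀ le_rfl)) (Real.exp_pos _)
  have tendsto_log_exp {a : ℝ} (ha : 0 < a) :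
      Tendsto (fun T : ℝ => (1 / T) * Real.log (a * Real.exp (δ * T))) atTop (𝓝 δ) := by
    have : Tendsto (fun T : ℝ => T⁻¹ * Real.log a + δ) atTop (𝓝 (0 * Real.log a + δ)) :=
      (tendsto_inv_atTop_zero.mul_const _).add_const _
    rw [zero_mul, zero_add] at this
    refine this.congr' ?_
    filter_upwards [eventually_gt_atTop 0] with T hT
    rw [Real.log_mul ha.ne' (Real.exp_pos _).ne', Real.log_exp]
    field_simp
  refine tendsto_of_tendsto_of_tendsto_of_le_of_le' (tendsto_log_exp hc) (tendsto_log_exp hC) ?_ ?_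
  · filter_upwards [eventually_ge_atTop T₀, eventually_ge_atTop 0] with T hT hT0
    have := hN T hT
    gcongr
  · filter_upwards [eventually_ge_atTop T₀, eventually_ge_atTop 0] with T hT hT0
    have N_pos : 0 < N T := lt_of_lt_of_le (by positivity) (hN T hT)
    have := hN' T hT
    gcongr

section Paths

variable {ι : Type*} {A : Matrix ι ι ℕ} {ℓ : ι → ℝ}

/-- The admissible words from `i` to `j` whose letters, the last one excepted, have total length
less than `T`. -/
def admissiblePaths (A : Matrix ι ι ℕ) (ℓ : ι → ℝ) (i j : ι) (T : ℝ) : Set (List ι) :=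
  {γ | γ.IsChain (fun d d' => A d d' = 1) ∧ γ.head? = some i ∧ γ.getLast? = some j ∧
    (γ.dropLast.map ℓ).sum < T}

theorem singleton_mem_admissiblePaths {i i' j : ι} {T : ℝ} :
    [i'] ∈ admissiblePaths A ℓ i j T ↔ i' = i ∧ i' = j ∧ 0 < T := by
  simp [admissiblePaths]

theorem cons_cons_mem_admissiblePaths {i i' j k : ι} {γ : List ι} {T : ℝ} :
    i' :: k :: γ ∈ admissiblePaths A ℓ i j T ↔
      i' = i ∧ A i k = 1 ∧ k :: γ ∈ admissiblePaths A ℓ k j (T - ℓ i) := by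
  simp only [admissiblePaths, Set.mem_ofPred_eq, List.isChain_cons_cons, List.head?_cons,
    Option.some.injEq, List.getLast?_cons_cons, List.dropLast_cons_cons, List.map_cons,
    List.sum_cons, lt_sub_iff_add_lt']
  constructor
  · rintro ⟨⟨hik, hγ⟩, rfl, hlast, hsum⟩
    exact ⟨rfl, hik, hγ, trivial, hlast, hsum⟩
  · rintro ⟨rfl, hik, hγ, -, hlast, hsum⟩
    exact ⟨⟨hik, hγ⟩, rfl, hlast, hsum⟩

theorem exists_mem_admissiblePaths (hA : Subshift.IsTransitive A) (ℓ : ι → ℝ) (i j : ι) :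
    ∃ T, (admissiblePaths A ℓ i j T).Nonempty := by
  obtain ⟨γ, hchain, hlast⟩ := List.exists_isChain_cons_of_relationReflTransGen (hA i j)
  exact ⟨_, i :: γ, hchain, rfl, (List.getLast?_eq_some_getLast _).trans (congrArg some hlast),
    lt_add_one _⟩

theorem admissiblePaths_mono (i j : ι) : Monotone (admissiblePaths A ℓ i j) :=
  fun _ _ hT _ hγ => ⟨hγ.1, hγ.2.1, hγ.2.2.1, hγ.2.2.2.trans_le hT⟩

theorem admissiblePaths_eq_empty (hℓ : ∀ i, 0 < ℓ i) (i j : ι) {T : ℝ} (hT : T ≤ 0) :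
    admissiblePaths A ℓ i j T = ∅ := by
  refine Set.eq_empty_of_forall_notMem fun γ hγ => (hγ.2.2.2.trans_le hT).not_ge ?_
  exact List.sum_nonneg fun x hx => by
    obtain ⟨d, -, rfl⟩ := List.mem_map.1 hx
    exact (hℓ d).le

theorem finite_setOf_sum_dropLast_lt [Finite ι] (hℓ : ∀ i, 0 < ℓ i) (T : ℝ) :
    {γ : List ι | (γ.dropLast.map ℓ).sum < T}.Finite := by
  obtain ⟨a, a_pos, a_le⟩ := exists_pos_forall_le hℓ
  obtain ⟨n, hn⟩ := Archimedean.arch T a_pos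
  refine (List.finite_length_le ι n).subset fun γ hγ => ?_
  have length_nsmul_lt : γ.dropLast.length • a < n • a := calc
    γ.dropLast.length • a = (γ.dropLast.map ℓ).length • a := by rw [List.length_map]
    _ ≤ (γ.dropLast.map ℓ).sum := List.card_nsmul_le_sum _ _ fun x hx => by
      obtain ⟨d, -, rfl⟩ := List.mem_map.1 hx
      exact a_le d
    _ < n • a := lt_of_lt_of_le hγ hn
  have length_lt := (nsmul_lt_nsmul_iff_left a_pos).1 length_nsmul_lt
  rw [List.length_dropLast] at length_lt
  exact Nat.le_of_pred_lt length_lt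

theorem finite_admissiblePaths [Finite ι] (hℓ : ∀ i, 0 < ℓ i) (i j : ι) (T : ℝ) :
    (admissiblePaths A ℓ i j T).Finite :=
  (finite_setOf_sum_dropLast_lt hℓ T).subset fun _ hγ => hγ.2.2.2

/-- The number of admissible words from `i` to `j` of length less than `T`. -/
noncomputable def pathCount (A : Matrix ι ι ℕ) (ℓ : ι → ℝ) (i j : ι) (T : ℝ) : ℝ :=
  (admissiblePaths A ℓ i j T).ncard

variable [Fintype ι]

theorem ncard_iUnion_admissiblePaths (hℓ : ∀ i, 0 < ℓ i) (i j : ι) (T : ℝ) :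
    ((⋃ k : {k // A i k = 1}, admissiblePaths A ℓ k j T).ncard : ℝ) =
      ∑ k : {k // A i k = 1}, pathCount A ℓ k j T := by
  rw [Set.ncard_iUnion_of_finite
    fun k : {k // A i k = 1} => finite_admissiblePaths hℓ k.1 j T, finsum_eq_sum_of_fintype,
    Nat.cast_sum]
  · rfl
  · refine fun k k' hkk' => Set.disjoint_left.2 fun γ hγ hγ' => hkk' (Subtype.ext ?_)
    exact Option.some_injective _ (hγ.2.1.symm.trans hγ'.2.1)

theorem sum_pathCount_le (hℓ : ∀ i, 0 < ℓ i) (i j : ι) (T : ℝ) :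
    ∑ k : {k // A i k = 1}, pathCount A ℓ k j (T - ℓ i) ≤ pathCount A ℓ i j T := by
  rw [← ncard_iUnion_admissiblePaths hℓ, pathCount,
    ← Set.ncard_image_of_injective _ (List.cons_injective (a := i))]
  refine Nat.cast_le.2 (Set.ncard_le_ncard ?_ (finite_admissiblePaths hℓ i j T))
  rintro _ ⟨γ, hγ, rfl⟩
  obtain ⟨k, hk⟩ := Set.mem_iUnion.1 hγ
  obtain ⟨γ', rfl⟩ := List.head?_eq_some_iff.1 hk.2.1
  exact cons_cons_mem_admissiblePaths.2 ⟨rfl, k.2, hk⟩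

theorem pathCount_le (hℓ : ∀ i, 0 < ℓ i) (i j : ι) (T : ℝ) :
    pathCount A ℓ i j T ≤ (∑ k : {k // A i k = 1}, pathCount A ℓ k j (T - ℓ i)) + 1 := by
  rw [← ncard_iUnion_admissiblePaths hℓ, pathCount,
    ← Set.ncard_image_of_injective (⋃ _, _) (List.cons_injective (a := i))]
  norm_cast
  have finite_iUnion := Set.finite_iUnion fun k : {k // A i k = 1} =>
    finite_admissiblePaths (A := A) hℓ k j (T - ℓ i)
  refine (Set.ncard_le_ncard ?_ ((finite_iUnion.image _).insert [i])).trans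
    (Set.ncard_insert_le _ _)
  rintro (_ | ⟨i', _ | ⟨k, γ⟩⟩) hγ
  · exact absurd hγ.2.1 (by simp)
  · exact .inl (congrArg (fun d => [d]) (singleton_mem_admissiblePaths.1 hγ).1)
  · obtain ⟨rfl, hk, hγ⟩ := cons_cons_mem_admissiblePaths.1 hγ
    exact .inr ⟨k :: γ, Set.mem_iUnion.2 ⟨⟨k, hk⟩, hγ⟩, rfl⟩

variable {δ : ℝ} {ρ : ι → ℝ}

theorem sum_mul_exp_sub
    (hρ : (Subshift.transferMat A fun i => -(δ * ℓ i)).mulVec ρ = ρ) (i : ι) (T : ℝ) :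
    ∑ k : {k // A i k = 1}, ρ k * Real.exp (δ * (T - ℓ i)) = ρ i * Real.exp (δ * T) := by
  have sum_eq : Real.exp (-(δ * ℓ i)) * ∑ k : {k // A i k = 1}, ρ k = ρ i := by
    conv_rhs => rw [← hρ]
    simp only [Matrix.mulVec, dotProduct, Subshift.transferMat, ite_mul, zero_mul]
    rw [← Finset.sum_filter, ← Finset.mul_sum, Finset.sum_subtype (p := fun k => A i k = 1)]
    exact fun k => by simp
  have exp_eq : Real.exp (δ * (T - ℓ i)) = Real.exp (-(δ * ℓ i)) * Real.exp (δ * T) := by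
    rw [← Real.exp_add]
    ring_nf
  rw [← Finset.sum_mul, exp_eq, ← sum_eq]
  ring

theorem exists_pathCount_le (hℓ : ∀ i, 0 < ℓ i) (hδ : 0 ≤ δ) (hpos : ∀ i, 0 < ρ i)
    (hρ : (Subshift.transferMat A fun i => -(δ * ℓ i)).mulVec ρ = ρ)
    (hout : ∀ i, 2 ≤ Fintype.card {k // A i k = 1}) :
    ∃ C, ∀ i j T, 0 ≤ T → pathCount A ℓ i j T ≤ C * (ρ i * Real.exp (δ * T)) := by
  set b := ∑ i, ℓ i
  have b_nonneg : 0 ≤ b := Finset.sum_nonneg fun i _ => (hℓ i).le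
  have le_b (i : ι) : ℓ i ≤ b :=
    Finset.single_le_sum (fun i _ => (hℓ i).le) (Finset.mem_univ i)
  set C := Real.exp (δ * b) * ∑ i, (ρ i)⁻¹
  have exp_le (i : ι) : Real.exp (δ * b) ≤ C * ρ i := by
    rw [← div_le_iff₀ (hpos i), div_eq_mul_inv]
    exact mul_le_mul_of_nonneg_left (Finset.single_le_sum (f := fun i => (ρ i)⁻¹)
      (fun i _ => (inv_pos.2 (hpos i)).le) (Finset.mem_univ i)) (Real.exp_pos _).le
  -- The `- 1` absorbs the `+ 1` of the recursion, as every letter has at least two successors.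
  have pathCount_le_sub_one (j : ι) : ∀ i T, -b ≤ T →
      pathCount A ℓ i j T ≤ C * (ρ i * Real.exp (δ * T)) - 1 := by
    refine renewal_induction hℓ le_b (fun i T hT hT' => ?_) fun i T _ ih => ?_
    · rw [pathCount, admissiblePaths_eq_empty hℓ i j (by linarith), Set.ncard_empty,
        Nat.cast_zero, sub_nonneg, ← mul_assoc]
      calc 1 = Real.exp (δ * b) * Real.exp (-(δ * b)) := by rw [← Real.exp_add, add_neg_cancel,
            Real.exp_zero]
        _ ≤ C * ρ i * Real.exp (δ * T) := by
          rw [← mul_neg]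
          gcongr
          · exact (Real.exp_pos _).le.trans (exp_le i)
          · exact exp_le i
    · calc pathCount A ℓ i j T
          ≤ ∑ k : {k // A i k = 1}, (C * (ρ k * Real.exp (δ * (T - ℓ i))) - 1) + 1 := by
            refine (pathCount_le hℓ i j T).trans ?_
            gcongr with k
            exact ih k
        _ = C * (ρ i * Real.exp (δ * T)) - Fintype.card {k // A i k = 1} + 1 := by
            rw [Finset.sum_sub_distrib, ← Finset.mul_sum, sum_mul_exp_sub hρ, Finset.sum_const,
              Finset.card_univ, nsmul_one]
        _ ≤ C * (ρ i * Real.exp (δ * T)) - 1 := by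
            have : (2 : ℝ) ≤ Fintype.card {k // A i k = 1} := mod_cast hout i
            linarith
  exact ⟨C, fun i j T hT => (pathCount_le_sub_one j i T (by linarith)).trans (by linarith)⟩

theorem exists_le_pathCount (hA : Subshift.IsTransitive A) (hℓ : ∀ i, 0 < ℓ i) (hδ : 0 ≤ δ)
    (hpos : ∀ i, 0 < ρ i) (hρ : (Subshift.transferMat A fun i => -(δ * ℓ i)).mulVec ρ = ρ)
    (j : ι) :
    ∃ c > 0, ∃ T₀, ∀ i T, T₀ ≤ T → c * (ρ i * Real.exp (δ * T)) ≤ pathCount A ℓ i j T := by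
  set b := ∑ i, ℓ i
  have le_b (i : ι) : ℓ i ≤ b :=
    Finset.single_le_sum (fun i _ => (hℓ i).le) (Finset.mem_univ i)
  choose τ hτ using fun i => exists_mem_admissiblePaths hA ℓ i j
  obtain ⟨T₀, hT₀⟩ := (Set.finite_range τ).bddAbove
  have one_le_pathCount (i : ι) {T : ℝ} (hT : T₀ ≤ T) : 1 ≤ pathCount A ℓ i j T := by
    have nonempty := (hτ i).mono (admissiblePaths_mono i j ((hT₀ ⟨i, rfl⟩).trans hT))
    exact Nat.one_le_cast.2 ((Set.ncard_pos (finite_admissiblePaths hℓ i j T)).2 nonempty)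
  set R := ∑ i, ρ i
  have R_pos : 0 < R := Finset.sum_pos (fun i _ => hpos i) ⟨j, Finset.mem_univ j⟩
  refine ⟨(R * Real.exp (δ * (T₀ + b)))⁻¹, by positivity, T₀,
    renewal_induction hℓ le_b (fun i T hT hT' => ?_) fun i T _ ih => ?_⟩
  · refine le_trans (inv_mul_le_one_of_le₀ ?_ (by positivity)) (one_le_pathCount i hT)
    gcongr
    exact Finset.single_le_sum (fun i _ => (hpos i).le) (Finset.mem_univ i)
  · rw [← sum_mul_exp_sub hρ, Finset.mul_sum]
    exact (Finset.sum_le_sum fun (k : {k // A i k = 1}) _ => ih k).trans (sum_pathCount_le hℓ i j T)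

end Paths

namespace MultiGraph

variable {V E : Type*} [DecidableEq V] [DecidableEq E] {G : MultiGraph V E} {l : E → ℝ}

theorem finite_setOf_cycleLength_lt [Finite E] (hl : ∀ e, 0 < l e) (T : ℝ) :
    {γ | G.IsClosedCycle γ ∧ G.cycleLength l γ < T}.Finite :=
  (finite_setOf_sum_dropLast_lt (fun d : G.DirEdge => hl d.1) T).subset fun _ hγ => hγ.2

theorem pathCount_le_ncard_cycles [Finite E] (hl : ∀ e, 0 < l e) {i k : G.DirEdge}
    (hik : G.adjMat i k = 1) (T : ℝ) :
    pathCount G.adjMat (fun d => l d.1) k i (T - l i.1) ≤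
      {γ | G.IsClosedCycle γ ∧ G.cycleLength l γ < T}.ncard := by
  rw [pathCount, ← Set.ncard_image_of_injective _ (List.cons_injective (a := i))]
  refine Nat.cast_le.2 (Set.ncard_le_ncard ?_ (finite_setOf_cycleLength_lt hl T))
  rintro _ ⟨γ, hγ, rfl⟩
  obtain ⟨γ', rfl⟩ := List.head?_eq_some_iff.1 hγ.2.1
  obtain ⟨hchain, hhead, hlast, hsum⟩ :=
    cons_cons_mem_admissiblePaths (ℓ := fun d : G.DirEdge => l d.1).2 ⟨rfl, hik, hγ⟩
  exact ⟨⟨Nat.le_add_left 2 _, hchain, hhead.trans hlast.symm⟩, hsum⟩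

theorem ncard_cycles_le_sum_pathCount [Fintype E] (hl : ∀ e, 0 < l e) (T : ℝ) :
    ({γ | G.IsClosedCycle γ ∧ G.cycleLength l γ < T}.ncard : ℝ) ≤
      ∑ i : G.DirEdge, pathCount G.adjMat (fun d => l d.1) i i T := by
  have subset_iUnion : {γ | G.IsClosedCycle γ ∧ G.cycleLength l γ < T} ⊆
      ⋃ i, admissiblePaths G.adjMat (fun d => l d.1) i i T := by
    rintro (_ | ⟨i, γ⟩) ⟨⟨hlength, hchain, hhead⟩, hsum⟩
    · simp at hlength
    · exact Set.mem_iUnion.2 ⟨i, hchain, rfl, hhead.symm, hsum⟩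
  refine (Nat.cast_le.2 ((Set.ncard_le_ncard subset_iUnion ?_).trans
    (Set.ncard_iUnion_le_of_fintype _))).trans_eq (Nat.cast_sum _ _)
  exact Set.finite_iUnion fun i => finite_admissiblePaths (fun d => hl d.1) i i T

theorem hasEntropy_of_mulVec_eq [Fintype E] [Nonempty E] (hl : ∀ e, 0 < l e)
    (hG : Subshift.IsTransitive G.adjMat)
    (hout : ∀ i : G.DirEdge, 2 ≤ Fintype.card {k // G.adjMat i k = 1}) {δ : ℝ} (hδ : 0 ≤ δ)
    {ρ : G.DirEdge → ℝ} (hpos : ∀ i, 0 < ρ i)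
    (hρ : (Subshift.transferMat G.adjMat fun d => -(δ * l d.1)).mulVec ρ = ρ) :
    G.HasEntropy l δ := by
  let i : G.DirEdge := (Classical.arbitrary E, false)
  obtain ⟨k, hik⟩ : ∃ k, G.adjMat i k = 1 :=
    nonempty_subtype.1 (Fintype.card_pos_iff.1 (two_pos.trans_le (hout i)))
  obtain ⟨c, c_pos, T₀, hc⟩ := exists_le_pathCount hG (fun d => hl d.1) hδ hpos hρ i
  obtain ⟨C, hC⟩ := exists_pathCount_le (fun d : G.DirEdge => hl d.1) hδ hpos hρ hout
  refine tendsto_one_div_mul_log_of_le (T₀ := max 0 (T₀ + l i.1))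
    (c := c * (ρ k * Real.exp (-(δ * l i.1)))) (C := C * ∑ i, ρ i)
    (mul_pos c_pos (mul_pos (hpos k) (Real.exp_pos _))) (fun T hT => ?_) fun T hT => ?_
  · calc c * (ρ k * Real.exp (-(δ * l i.1))) * Real.exp (δ * T)
        = c * (ρ k * Real.exp (δ * (T - l i.1))) := by
          rw [mul_assoc, mul_assoc, ← Real.exp_add]
          ring_nf
      _ ≤ _ := hc k _ (le_sub_iff_add_le.2 ((le_max_right _ _).trans hT))
      _ ≤ _ := pathCount_le_ncard_cycles hl hik T
  · calc ({γ | G.IsClosedCycle γ ∧ G.cycleLength l γ < T}.ncard : ℝ)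
        ≤ ∑ i : G.DirEdge, pathCount G.adjMat (fun d => l d.1) i i T :=
          ncard_cycles_le_sum_pathCount hl T
      _ ≤ ∑ i, C * (ρ i * Real.exp (δ * T)) :=
          Finset.sum_le_sum fun i _ => hC i i T ((le_max_left _ _).trans hT)
      _ = C * (∑ i, ρ i) * Real.exp (δ * T) := by
          rw [← Finset.mul_sum, ← Finset.sum_mul, mul_assoc]

end MultiGraph

/-! ### The belt buckle -/

namespace MultiGraph

variable {V E : Type*} [DecidableEq V] [DecidableEq E]

theorem weightedMat_eq_transferMat (G : MultiGraph V E) (l : E → ℝ) :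
    G.weightedMat l = Subshift.transferMat G.adjMat fun d => -l d.1 := by
  ext i j
  rw [weightedMat, Subshift.transferMat, adjMat]
  split_ifs <;> simp_all

variable [Fintype E]

theorem stochMat_mulVec (G : MultiGraph V E) (l : E → ℝ) (v p : G.DirEdge → ℝ) :
    (G.stochMat l v).mulVec p = v * (G.weightedMat l).mulVec (p / v) := by
  ext i
  simp only [Matrix.mulVec, dotProduct, stochMat, weightedMat, Pi.mul_apply, Pi.div_apply,
    Finset.mul_sum]
  exact Finset.sum_congr rfl fun j _ => by ring

theorem isStationaryVec_iff {G : MultiGraph V E} {l : E → ℝ} {h ρ : G.DirEdge → ℝ} [Nonempty E]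
    (H : Subshift.IsPerronPair G.adjMat (fun d => -l d.1) h ρ) {p : G.DirEdge → ℝ} :
    G.IsStationaryVec l p ↔ p = (∑ d, h d * ρ d)⁻¹ • (h * ρ) := by
  have sum_pos : 0 < ∑ d, h d * ρ d :=
    Finset.sum_pos (fun d _ => mul_pos (H.left_pos d) (H.right_pos d)) Finset.univ_nonempty
  simp only [IsStationaryVec, stochMat_mulVec, weightedMat_eq_transferMat]
  constructor
  · rintro ⟨v, v_pos, hv, hp, sum_p⟩
    have v_ne_zero (d : G.DirEdge) : v d ≠ 0 := (v_pos d).ne'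
    obtain ⟨c, rfl⟩ := H.exists_eq_smul_left hv
    obtain ⟨k, hk⟩ := H.exists_eq_smul_right (w := p / (c • h)) <| by
      funext d
      rw [Pi.div_apply, eq_div_iff (v_ne_zero d), mul_comm]
      exact congrFun hp d
    have p_eq : p = (k * c) • (h * ρ) := by
      funext d
      have := (div_eq_iff (v_ne_zero d)).1 (congrFun hk d)
      simp only [Pi.smul_apply, Pi.mul_apply, smul_eq_mul] at this ⊢
      rw [this]
      ring
    simp only [p_eq, Pi.smul_apply, Pi.mul_apply, smul_eq_mul, ← Finset.mul_sum] at sum_p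
    rw [p_eq, eq_inv_of_mul_eq_one_left sum_p]
  · rintro rfl
    refine ⟨h, H.left_pos, H.vecMul_left, ?_, ?_⟩
    · have div_left : (∑ d, h d * ρ d)⁻¹ • (h * ρ) / h = (∑ d, h d * ρ d)⁻¹ • ρ := by
        funext d
        have := (H.left_pos d).ne'
        simp only [Pi.div_apply, Pi.smul_apply, Pi.mul_apply, smul_eq_mul]
        field_simp
      rw [div_left, Matrix.mulVec_smul, H.mulVec_right, mul_smul_comm]
    · simp only [Pi.smul_apply, Pi.mul_apply, smul_eq_mul, ← Finset.mul_sum]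
      exact inv_mul_cancel₀ sum_pos.ne'

end MultiGraph

/-- The density `σ'` of the logistic distribution, `σ` being the sigmoid function. -/
noncomputable def logisticDensity (a : ℝ) : ℝ := Real.sigmoid a * (1 - Real.sigmoid a)

theorem logisticDensity_pos (a : ℝ) : 0 < logisticDensity a :=
  mul_pos (Real.sigmoid_pos a) (sub_pos.2 (Real.sigmoid_lt_one a))

theorem hasDerivAt_logisticDensity (a : ℝ) :
    HasDerivAt logisticDensity (logisticDensity a * (1 - 2 * Real.sigmoid a)) a := by
  have := Real.hasDerivAt_sigmoid a
  exact (this.mul (this.const_sub 1)).congr_deriv (by rw [logisticDensity]; ring)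

theorem sigmoid_eq_exp_div (a : ℝ) : Real.sigmoid a = Real.exp a / (Real.exp a + 1) := by
  rw [Real.sigmoid_def, Real.exp_neg]
  field_simp

theorem logisticDensity_eq (a : ℝ) :
    logisticDensity a = Real.exp a / (Real.exp a + 1) ^ 2 := by
  rw [logisticDensity, sigmoid_eq_exp_div]
  field_simp
  ring

namespace BeltBuckle

theorem adjMat_eq_one_iff (d d' : graph.DirEdge) :
    graph.adjMat d d' = 1 ↔ d'.1 ≠ d.1 ∧ d'.2 = !d.2 := by
  obtain ⟨e, b⟩ := d
  obtain ⟨e', b'⟩ := d'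
  cases b <;> cases b' <;>
    simp [MultiGraph.adjMat, MultiGraph.origin, MultiGraph.terminus, MultiGraph.opposite, graph]

theorem isTransitive_adjMat : Subshift.IsTransitive graph.adjMat := by
  have exists_path : ∀ i j : graph.DirEdge, ∃ k m, graph.adjMat i k = 1 ∧ graph.adjMat k m = 1 ∧
      (m = j ∨ graph.adjMat m j = 1) := by
    simp only [adjMat_eq_one_iff]
    decide
  intro i j
  obtain ⟨k, m, hik, hkm, rfl | hmj⟩ := exists_path i j
  · exact .tail (.single hik) hkm
  · exact .tail (.tail (.single hik) hkm) hmj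

theorem card_successors_adjMat (i : graph.DirEdge) :
    Fintype.card {k // graph.adjMat i k = 1} = 2 := by
  simp only [adjMat_eq_one_iff]
  revert i
  decide

instance : Nonempty (Subshift graph.adjMat) :=
  ⟨⟨fun n => (fun d : graph.DirEdge => (d.1 + 1, !d.2))^[n] (0, false), fun n => by
    refine (adjMat_eq_one_iff _ _).2 ?_
    simp only [Function.iterate_succ_apply']
    exact ⟨by simp, trivial⟩⟩⟩

theorem sum_dirEdge (φ : Fin 3 → ℝ) : ∑ d : graph.DirEdge, φ d.1 = 2 * ∑ e, φ e := by
  simp [Fintype.sum_prod_type, Finset.mul_sum]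

theorem vecMul_transferMat (w φ : Fin 3 → ℝ) (j : graph.DirEdge) :
    Matrix.vecMul (fun i => w i.1) (Subshift.transferMat graph.adjMat fun i => φ i.1) j =
      ∑ e, w e * Real.exp (φ e) - w j.1 * Real.exp (φ j.1) := by
  obtain ⟨e, b⟩ := j
  simp only [Matrix.vecMul, dotProduct, Subshift.transferMat, adjMat_eq_one_iff,
    Fintype.sum_prod_type, Fintype.sum_bool, Fin.sum_univ_three]
  fin_cases e <;> cases b <;> simp <;> ring

theorem mulVec_transferMat (w φ : Fin 3 → ℝ) (i : graph.DirEdge) :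
    (Subshift.transferMat graph.adjMat fun i => φ i.1).mulVec (fun i => w i.1) i =
      Real.exp (φ i.1) * (∑ e, w e - w i.1) := by
  obtain ⟨e, b⟩ := i
  simp only [Matrix.mulVec, dotProduct, Subshift.transferMat, adjMat_eq_one_iff,
    Fintype.sum_prod_type, Fintype.sum_bool, Fin.sum_univ_three]
  fin_cases e <;> cases b <;> simp <;> ring

section Gibbs

variable {l : Fin 3 → ℝ}

theorem isPerronPair (hl : ∑ e, Real.sigmoid (-l e) = 1) :
    Subshift.IsPerronPair graph.adjMat (fun d => -l d.1) (fun d => Real.sigmoid (l d.1))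
      fun d => Real.sigmoid (-l d.1) where
  isTransitive := isTransitive_adjMat
  left_pos _ := Real.sigmoid_pos _
  vecMul_left := by
    funext j
    rw [vecMul_transferMat (fun e => Real.sigmoid (l e)) fun e => -l e]
    simp only [Real.sigmoid_mul_rexp_neg, hl]
    rw [← Real.sigmoid_neg, neg_neg]
  right_pos _ := Real.sigmoid_pos _
  mulVec_right := by
    funext i
    rw [mulVec_transferMat (fun e => Real.sigmoid (-l e)) fun e => -l e, hl, ← Real.sigmoid_neg,
      neg_neg, mul_comm, Real.sigmoid_mul_rexp_neg]

theorem hasEntropy (l_pos : ∀ e, 0 < l e) {δ : ℝ} (hδ : 0 ≤ δ)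
    (hl : ∑ e, Real.sigmoid (-(δ * l e)) = 1) : graph.HasEntropy l δ :=
  MultiGraph.hasEntropy_of_mulVec_eq l_pos isTransitive_adjMat
    (fun i => (card_successors_adjMat i).ge) hδ (isPerronPair hl).right_pos
    (isPerronPair hl).mulVec_right

theorem exists_sum_sigmoid_eq_one (l_pos : ∀ e, 0 < l e) :
    ∃ δ, 0 ≤ δ ∧ ∑ e, Real.sigmoid (-(δ * l e)) = 1 := by
  have sum_at_zero : 1 ≤ ∑ e, Real.sigmoid (-(0 * l e)) := by norm_num
  have sum_at_infty : Tendsto (fun δ => ∑ e, Real.sigmoid (-(δ * l e))) atTop (𝓝 0) := by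
    rw [← Finset.sum_const_zero (s := (Finset.univ : Finset (Fin 3)))]
    exact tendsto_finsetSum _ fun e _ => Real.tendsto_sigmoid_atBot.comp
      (tendsto_neg_atTop_atBot.comp (tendsto_id.atTop_mul_const (l_pos e)))
  obtain ⟨N, hN, N_nonneg⟩ :=
    ((sum_at_infty.eventually (gt_mem_nhds one_pos)).and (eventually_ge_atTop 0)).exists
  have sum_continuous : Continuous fun δ => ∑ e, Real.sigmoid (-(δ * l e)) := by fun_prop
  obtain ⟨δ, hδ, sum_eq⟩ := intermediate_value_Icc' N_nonneg sum_continuous.continuousOn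
    ⟨hN.le, sum_at_zero⟩
  exact ⟨δ, hδ.1, sum_eq⟩

theorem mem_moduliOne_iff :
    l ∈ graph.moduliOne ↔ (∀ e, 0 < l e) ∧ ∑ e, Real.sigmoid (-l e) = 1 := by
  refine and_congr_right fun l_pos => ⟨fun entropy_one => ?_, fun hl => ?_⟩
  · obtain ⟨δ, hδ, sum_eq⟩ := exists_sum_sigmoid_eq_one l_pos
    obtain rfl := tendsto_nhds_unique (hasEntropy l_pos hδ sum_eq) entropy_one
    simpa only [one_mul] using sum_eq
  · exact hasEntropy l_pos zero_le_one (by simpa only [one_mul] using hl)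

theorem sigmoid_mul_sigmoid_neg (a : ℝ) :
    Real.sigmoid a * Real.sigmoid (-a) = logisticDensity a := by
  rw [Real.sigmoid_neg, logisticDensity]

theorem isStationaryVec_iff (hl : ∑ e, Real.sigmoid (-l e) = 1) {p : graph.DirEdge → ℝ} :
    graph.IsStationaryVec l p ↔
      p = fun d => logisticDensity (l d.1) / (2 * ∑ e, logisticDensity (l e)) := by
  rw [MultiGraph.isStationaryVec_iff (isPerronPair hl)]
  simp only [sigmoid_mul_sigmoid_neg]
  rw [sum_dirEdge fun e => logisticDensity (l e)]
  refine Eq.congr_right (funext fun d => ?_)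
  rw [Pi.smul_apply, Pi.mul_apply, sigmoid_mul_sigmoid_neg, smul_eq_mul, div_eq_inv_mul]

variable {m : Measure (Subshift graph.adjMat)}

theorem integral_edgeFun (hl : ∑ e, Real.sigmoid (-l e) = 1)
    (hm : Subshift.IsEquilibriumState (-graph.edgeFun l) m) (φ : Fin 3 → ℝ) :
    ∫ x, graph.edgeFun φ x ∂m =
      (∑ e, φ e * logisticDensity (l e)) / ∑ e, logisticDensity (l e) := by
  have := (isPerronPair hl).integral_letterFun_equilibrium hm fun d => φ d.1
  simp only [sigmoid_mul_sigmoid_neg] at this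
  rwa [sum_dirEdge fun e => φ e * logisticDensity (l e), sum_dirEdge fun e => logisticDensity (l e),
    mul_div_mul_left _ _ two_ne_zero] at this

theorem edgeFun_mem_tangentSpace (hl : ∑ e, Real.sigmoid (-l e) = 1)
    (hm : Subshift.IsEquilibriumState (-graph.edgeFun l) m) {φ : Fin 3 → ℝ}
    (hφ : ∑ e, φ e * logisticDensity (l e) = 0) : ⇑(graph.edgeFun φ) ∈ graph.tangentSpace m :=
  ⟨⟨fun d => φ d.1, fun _ => rfl⟩, by rw [integral_edgeFun hl hm, hφ, zero_div]⟩

-- The decomposition `φ = φ σ(l) - (-φ σ(-l))` exhibits `φ` as the reverse martingale difference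
-- `u - g ∘ shift` up to a coboundary.
theorem hasVariance_edgeFun (hl : ∑ e, Real.sigmoid (-l e) = 1)
    (hm : Subshift.IsEquilibriumState (-graph.edgeFun l) m) {φ : Fin 3 → ℝ}
    (hφ : ∑ e, φ e * logisticDensity (l e) = 0) :
    Subshift.HasVariance (graph.edgeFun φ) m
      (-(∑ e, φ e ^ 2 * deriv logisticDensity (l e)) / ∑ e, logisticDensity (l e)) := by
  let u (d : graph.DirEdge) : ℝ := φ d.1 * Real.sigmoid (l d.1)
  let g (d : graph.DirEdge) : ℝ := -(φ d.1 * Real.sigmoid (-l d.1))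
  have hug : Matrix.vecMul (u * fun d => Real.sigmoid (l d.1))
      (Subshift.transferMat graph.adjMat fun d => -l d.1) = g * fun d => Real.sigmoid (l d.1) := by
    funext j
    refine (vecMul_transferMat
      (fun e => φ e * Real.sigmoid (l e) * Real.sigmoid (l e)) (fun e => -l e) j).trans ?_
    simp only [mul_assoc, Real.sigmoid_mul_rexp_neg, sigmoid_mul_sigmoid_neg, hφ, Pi.mul_apply, g]
    rw [zero_sub, ← sigmoid_mul_sigmoid_neg]
    ring
  have hφug : graph.edgeFun φ = Subshift.letterFun graph.adjMat (u - g) := by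
    ext x
    simp only [MultiGraph.edgeFun, ContinuousMap.coe_mk, Subshift.letterFun_apply, Pi.sub_apply, u,
      g, Real.sigmoid_neg]
    ring
  have sq_sub_sq (e : Fin 3) : ((φ e * Real.sigmoid (l e)) ^ 2 -
      (-(φ e * Real.sigmoid (-l e))) ^ 2) * logisticDensity (l e) =
        -(φ e ^ 2 * deriv logisticDensity (l e)) := by
    rw [(hasDerivAt_logisticDensity _).deriv, Real.sigmoid_neg]
    ring
  have variance := (isPerronPair hl).hasVariance_letterFun_sub hm hug
  simp only [u, g, sigmoid_mul_sigmoid_neg, sq_sub_sq] at variance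
  rwa [← hφug, sum_dirEdge fun e => -(φ e ^ 2 * deriv logisticDensity (l e)),
    sum_dirEdge fun e => logisticDensity (l e), mul_div_mul_left _ _ two_ne_zero,
    Finset.sum_neg_distrib] at variance

end Gibbs

theorem exp_S {x y : ℝ} (hxy : 0 < x + y) :
    Real.exp (S x y) = (Real.exp x + Real.exp y + 2) / (Real.exp (x + y) - 1) := by
  have : 0 < Real.exp (x + y) - 1 := sub_pos.2 (Real.one_lt_exp_iff.2 hxy)
  rw [S, Real.exp_neg, Real.exp_log (by positivity), inv_div]

theorem sigmoid_S {x y : ℝ} (hxy : 0 < x + y) :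
    Real.sigmoid (S x y) = 2 - Real.sigmoid x - Real.sigmoid y := by
  have exp_sub_one_ne_zero : Real.exp (x + y) - 1 ≠ 0 :=
    (sub_pos.2 (Real.one_lt_exp_iff.2 hxy)).ne'
  have exp_S_add_one : Real.exp (S x y) + 1 =
      (Real.exp x + 1) * (Real.exp y + 1) / (Real.exp (x + y) - 1) := by
    rw [exp_S hxy, eq_div_iff exp_sub_one_ne_zero, add_mul, div_mul_cancel₀ _ exp_sub_one_ne_zero,
      Real.exp_add]
    ring
  simp only [sigmoid_eq_exp_div]
  rw [exp_S_add_one, exp_S hxy]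
  field_simp
  ring

theorem sum_sigmoid_neg_l {x y : ℝ} (hxy : 0 < x + y) :
    ∑ e, Real.sigmoid (-l x y e) = 1 := by
  have : Real.sigmoid (-x) + Real.sigmoid (-y) + Real.sigmoid (-S x y) = 1 := by
    simp only [Real.sigmoid_neg, sigmoid_S hxy]
    ring
  rwa [Fin.sum_univ_three]

theorem S_pos_iff {x y : ℝ} (hxy : 0 < x + y) :
    0 < S x y ↔ Real.exp (x + y) < 3 + Real.exp x + Real.exp y := by
  rw [← Real.one_lt_exp_iff, exp_S hxy, one_lt_div (sub_pos.2 (Real.one_lt_exp_iff.2 hxy))]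
  constructor <;> intro <;> linarith

theorem bijOn_l : Set.BijOn (fun q : ℝ × ℝ => l q.1 q.2) domain graph.moduliOne := by
  refine ⟨?_, fun q _ q' _ h => Prod.ext (congrFun h 0) (congrFun h 1), ?_⟩
  · rintro ⟨x, y⟩ ⟨hx, hy, hlt⟩
    have hxy : 0 < x + y := add_pos hx hy
    refine mem_moduliOne_iff.2 ⟨fun e => ?_, sum_sigmoid_neg_l hxy⟩
    fin_cases e
    exacts [hx, hy, (S_pos_iff hxy).2 hlt]
  · intro l' hl'
    obtain ⟨l'_pos, sum_eq⟩ := mem_moduliOne_iff.1 hl'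
    have hxy : 0 < l' 0 + l' 1 := add_pos (l'_pos 0) (l'_pos 1)
    have eq_S : l' 2 = S (l' 0) (l' 1) := by
      simp only [Fin.sum_univ_three, Real.sigmoid_neg] at sum_eq
      refine Real.sigmoid_injective ?_
      rw [sigmoid_S hxy]
      linarith
    refine ⟨(l' 0, l' 1), ⟨l'_pos 0, l'_pos 1, (S_pos_iff hxy).1 (eq_S ▸ l'_pos 2)⟩, ?_⟩
    funext e
    fin_cases e
    exacts [rfl, rfl, eq_S.symm]

theorem S_comm (x y : ℝ) : S x y = S y x := by
  rw [S, S, add_comm x y, add_comm (Real.exp x)]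

/-- The partial derivative `∂S/∂x`, in the form given by implicit differentiation of the equation
`σ(x) + σ(y) + σ(S(x, y)) = 2` of the surface. -/
noncomputable def Sx (x y : ℝ) : ℝ := -logisticDensity x / logisticDensity (S x y)

section Derivatives

variable {x y : ℝ} (hxy : 0 < x + y)
include hxy

theorem eventually_add_pos : ∀ᶠ t in 𝓝 x, 0 < t + y :=
  (continuous_id.add continuous_const).continuousAt.eventually (lt_mem_nhds hxy)

theorem hasDerivAt_S : HasDerivAt (fun t => S t y) (Sx x y) x := by
  have quotient_ne_zero : (Real.exp (x + y) - 1) / (Real.exp x + Real.exp y + 2) ≠ 0 :=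
    div_ne_zero (sub_pos.2 (Real.one_lt_exp_iff.2 hxy)).ne' (by positivity)
  have hS : DifferentiableAt ℝ (fun t => S t y) x := by
    unfold S
    refine DifferentiableAt.fun_neg (DifferentiableAt.log ?_ quotient_ne_zero)
    fun_prop (disch := positivity)
  have deriv_left : HasDerivAt (fun t => Real.sigmoid (S t y))
      (logisticDensity (S x y) * deriv (fun t => S t y) x) x :=
    (Real.hasDerivAt_sigmoid _).comp x hS.hasDerivAt
  have deriv_right : HasDerivAt (fun t => 2 - Real.sigmoid t - Real.sigmoid y)
      (-logisticDensity x) x :=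
    ((Real.hasDerivAt_sigmoid x).const_sub 2).sub_const _
  have sides_eq := deriv_left.unique <| deriv_right.congr_of_eventuallyEq <|
    (eventually_add_pos hxy).mono fun t => sigmoid_S
  rw [Sx, ← sides_eq, mul_div_cancel_left₀ _ (logisticDensity_pos _).ne']
  exact hS.hasDerivAt

theorem hasDerivAt_S_right : HasDerivAt (fun t => S x t) (Sx y x) y := by
  simp_rw [S_comm x]
  exact hasDerivAt_S (by rwa [add_comm])

theorem dlx_eq : dlx x y = ![1, 0, Sx x y] := by
  refine HasDerivAt.deriv (hasDerivAt_pi.2 fun e => ?_)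
  fin_cases e
  exacts [hasDerivAt_id x, hasDerivAt_const x y, hasDerivAt_S hxy]

theorem dly_eq : dly x y = ![0, 1, Sx y x] := by
  refine HasDerivAt.deriv (hasDerivAt_pi.2 fun e => ?_)
  fin_cases e
  exacts [hasDerivAt_const y x, hasDerivAt_id y, hasDerivAt_S_right hxy]

theorem tangent_eq (a b : ℝ) :
    a • dlx x y + b • dly x y = ![a, b, a * Sx x y + b * Sx y x] := by
  rw [dlx_eq hxy, dly_eq hxy]
  funext e
  fin_cases e <;> simp

theorem hasDerivAt_logisticDensity_S : HasDerivAt (fun t => logisticDensity (S t y))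
    (deriv logisticDensity (S x y) * Sx x y) x :=
  (hasDerivAt_logisticDensity _).differentiableAt.hasDerivAt.comp x (hasDerivAt_S hxy)

theorem Sxx_eq : Sxx x y = -(deriv logisticDensity x + Sx x y ^ 2 * deriv logisticDensity (S x y)) /
    logisticDensity (S x y) := by
  have w_ne_zero := (logisticDensity_pos (S x y)).ne'
  have hSx : HasDerivAt (fun t => Sx t y) _ x :=
    (hasDerivAt_logisticDensity x).differentiableAt.hasDerivAt.fun_neg.fun_div
      (hasDerivAt_logisticDensity_S hxy) w_ne_zero
  have deriv_eq : (fun t => deriv (fun s => S s y) t) =ᶠ[𝓝 x] fun t => Sx t y :=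
    (eventually_add_pos hxy).mono fun t ht => (hasDerivAt_S ht).deriv
  rw [Sxx, deriv_eq.deriv_eq, hSx.deriv, Sx]
  field_simp
  ring

theorem Sxy_eq : Sxy x y =
    -(Sx x y * Sx y x * deriv logisticDensity (S x y)) / logisticDensity (S x y) := by
  have w_ne_zero := (logisticDensity_pos (S x y)).ne'
  have hSy : HasDerivAt (fun s => -logisticDensity y / logisticDensity (S s y)) _ x :=
    (hasDerivAt_const x _).fun_div (hasDerivAt_logisticDensity_S hxy) w_ne_zero
  have deriv_eq : (fun s => deriv (fun t => S s t) y) =ᶠ[𝓝 x]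
      fun s => -logisticDensity y / logisticDensity (S s y) :=
    (eventually_add_pos hxy).mono fun s hs => by
      beta_reduce
      rw [(hasDerivAt_S_right hs).deriv, Sx, S_comm y s]
  rw [Sxy, deriv_eq.deriv_eq, hSy.deriv, Sx, Sx, S_comm y x]
  field_simp
  ring

end Derivatives

theorem Syy_eq_Sxx (x y : ℝ) : Syy x y = Sxx y x := by
  simp only [Syy, Sxx, S_comm x]

/-- The entry `𝐩₃` of the vector `p_{-l}` at `e₃`, for `l = l(x, y)`. -/
noncomputable def p₃ (x y : ℝ) : ℝ :=
  logisticDensity (S x y) / (2 * ∑ e, logisticDensity (l x y e))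

theorem sum_logisticDensity_l (x y : ℝ) : ∑ e, logisticDensity (l x y e) =
    logisticDensity x + logisticDensity y + logisticDensity (S x y) :=
  Fin.sum_univ_three _

theorem p₃_comm (x y : ℝ) : p₃ x y = p₃ y x := by
  rw [p₃, p₃, sum_logisticDensity_l, sum_logisticDensity_l, S_comm x, add_comm (logisticDensity x)]

/-- The polynomial `3XY + X²Y + XY² - 1` in `X = e^x` and `Y = e^y`, the numerator of the total
mass `∑ σ'(lₑ)` at `l = l(x, y)`. -/
noncomputable def massPoly (x y : ℝ) : ℝ :=
  3 * (Real.exp x * Real.exp y) + Real.exp x ^ 2 * Real.exp y + Real.exp x * Real.exp y ^ 2 - 1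

theorem denom_eq (x y : ℝ) : denom x y =
    2 * (Real.exp x + Real.exp y + 2) * (Real.exp x * Real.exp y - 1) * massPoly x y := by
  simp only [denom, massPoly, two_mul, Real.exp_add, sq]

theorem GP_eq_EP (x y : ℝ) : GP x y = EP y x := by
  rw [GP, EP, denom_eq, denom_eq, massPoly, massPoly, add_comm x (2 * y)]
  ring_nf

section Tangent

variable {x y : ℝ} (hxy : 0 < x + y)
include hxy

theorem exp_mul_exp_sub_one_pos : 0 < Real.exp x * Real.exp y - 1 := by
  rw [← Real.exp_add]
  exact sub_pos.2 (Real.one_lt_exp_iff.2 hxy)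

theorem massPoly_pos : 0 < massPoly x y := by
  have := exp_mul_exp_sub_one_pos hxy
  have : 0 < Real.exp x ^ 2 * Real.exp y + Real.exp x * Real.exp y ^ 2 := by positivity
  rw [massPoly]
  linarith

theorem logisticDensity_S : logisticDensity (S x y) =
    (Real.exp x + Real.exp y + 2) * (Real.exp x * Real.exp y - 1) /
      ((Real.exp x + 1) ^ 2 * (Real.exp y + 1) ^ 2) := by
  rw [logisticDensity, sigmoid_S hxy, sigmoid_eq_exp_div, sigmoid_eq_exp_div]
  field_simp
  ring

theorem deriv_logisticDensity_S : deriv logisticDensity (S x y) =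
    (Real.exp x + Real.exp y + 2) * (Real.exp x * Real.exp y - 1) *
      (Real.exp x * Real.exp y - Real.exp x - Real.exp y - 3) /
        ((Real.exp x + 1) ^ 3 * (Real.exp y + 1) ^ 3) := by
  rw [(hasDerivAt_logisticDensity _).deriv, logisticDensity_S hxy, sigmoid_S hxy,
    sigmoid_eq_exp_div, sigmoid_eq_exp_div]
  field_simp
  ring

theorem p₃_eq : p₃ x y =
    (Real.exp x + Real.exp y + 2) * (Real.exp x * Real.exp y - 1) / (4 * massPoly x y) := by
  have total_mass : ∑ e, logisticDensity (l x y e) =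
      2 * massPoly x y / ((Real.exp x + 1) ^ 2 * (Real.exp y + 1) ^ 2) := by
    rw [sum_logisticDensity_l, logisticDensity_S hxy, logisticDensity_eq, logisticDensity_eq,
      massPoly]
    field_simp
    ring
  have massPoly_ne_zero := (massPoly_pos hxy).ne'
  rw [p₃, total_mass, logisticDensity_S hxy]
  field_simp
  ring

theorem two_mul_Sxx_mul_p₃ : 2 * Sxx x y * p₃ x y = EP x y := by
  have := (exp_mul_exp_sub_one_pos hxy).ne'
  have := (massPoly_pos hxy).ne'
  rw [Sxx_eq hxy, Sx, p₃_eq hxy, EP, denom_eq, deriv_logisticDensity_S hxy, logisticDensity_S hxy,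
    (hasDerivAt_logisticDensity x).deriv, logisticDensity_eq, sigmoid_eq_exp_div,
    Real.exp_add, two_mul x, Real.exp_add]
  field_simp
  ring

theorem two_mul_Sxy_mul_p₃ : 2 * Sxy x y * p₃ x y = FP x y := by
  have := (exp_mul_exp_sub_one_pos hxy).ne'
  have := (massPoly_pos hxy).ne'
  rw [Sxy_eq hxy, Sx, Sx, S_comm y x, p₃_eq hxy, FP, denom_eq, deriv_logisticDensity_S hxy,
    logisticDensity_S hxy, logisticDensity_eq, logisticDensity_eq, Real.exp_add]
  field_simp
  ring

theorem two_mul_Syy_mul_p₃ : 2 * Syy x y * p₃ x y = GP x y := by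
  rw [Syy_eq_Sxx, p₃_comm, GP_eq_EP, two_mul_Sxx_mul_p₃ (by rwa [add_comm])]

theorem sum_tangent_mul_logisticDensity (a b : ℝ) :
    ∑ e, (a • dlx x y + b • dly x y) e * logisticDensity (l x y e) = 0 := by
  rw [tangent_eq hxy, Fin.sum_univ_three]
  change a * logisticDensity x + b * logisticDensity y +
    (a * Sx x y + b * Sx y x) * logisticDensity (S x y) = 0
  have := (logisticDensity_pos (S x y)).ne'
  rw [Sx, Sx, S_comm y x]
  field_simp
  ring

variable {m : Measure (Subshift graph.adjMat)}
  (hm : Subshift.IsEquilibriumState (-graph.edgeFun (l x y)) m)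
include hm

theorem edgeFun_tangent_mem_tangentSpace (a b : ℝ) :
    ⇑(graph.edgeFun (a • dlx x y + b • dly x y)) ∈ graph.tangentSpace m :=
  edgeFun_mem_tangentSpace (sum_sigmoid_neg_l hxy) hm (sum_tangent_mul_logisticDensity hxy a b)

theorem hasVariance_tangent_hessian (a b : ℝ) :
    Subshift.HasVariance (graph.edgeFun (a • dlx x y + b • dly x y)) m
      (2 * (a ^ 2 * Sxx x y + 2 * a * b * Sxy x y + b ^ 2 * Syy x y) * p₃ x y) := by
  have := (logisticDensity_pos (S x y)).ne'
  convert hasVariance_edgeFun (sum_sigmoid_neg_l hxy) hm (sum_tangent_mul_logisticDensity hxy a b)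
    using 1
  have hessian : ∑ e, (a • dlx x y + b • dly x y) e ^ 2 * deriv logisticDensity (l x y e) =
      a ^ 2 * deriv logisticDensity x + b ^ 2 * deriv logisticDensity y +
        (a * Sx x y + b * Sx y x) ^ 2 * deriv logisticDensity (S x y) := by
    rw [tangent_eq hxy]
    exact Fin.sum_univ_three _
  rw [hessian, Sxx_eq hxy, Sxy_eq hxy, Syy_eq_Sxx, Sxx_eq (by rwa [add_comm]), S_comm y x, p₃]
  field_simp
  ring

theorem hasVariance_tangent (a b : ℝ) :
    Subshift.HasVariance (graph.edgeFun (a • dlx x y + b • dly x y)) m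
      (a ^ 2 * EP x y + 2 * a * b * FP x y + b ^ 2 * GP x y) := by
  convert hasVariance_tangent_hessian hxy hm a b using 1
  rw [← two_mul_Sxx_mul_p₃ hxy, ← two_mul_Sxy_mul_p₃ hxy, ← two_mul_Syy_mul_p₃ hxy]
  ring

end Tangent

end BeltBuckle

theorem proposition4p3_general {x y : ℝ} (hxy : 0 < x + y) :
    (∃! m : Measure (Subshift BeltBuckle.graph.adjMat),
      Subshift.IsEquilibriumState (-BeltBuckle.graph.edgeFun (BeltBuckle.l x y)) m) ∧
    (∃! p : BeltBuckle.graph.DirEdge → ℝ,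
      BeltBuckle.graph.IsStationaryVec (BeltBuckle.l x y) p) ∧
    ∀ (m : Measure (Subshift BeltBuckle.graph.adjMat)) (p : BeltBuckle.graph.DirEdge → ℝ),
      Subshift.IsEquilibriumState (-BeltBuckle.graph.edgeFun (BeltBuckle.l x y)) m →
      BeltBuckle.graph.IsStationaryVec (BeltBuckle.l x y) p →
      ⇑(BeltBuckle.graph.edgeFun (BeltBuckle.dlx x y)) ∈ BeltBuckle.graph.tangentSpace m ∧
      ⇑(BeltBuckle.graph.edgeFun (BeltBuckle.dly x y)) ∈ BeltBuckle.graph.tangentSpace m ∧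
      (∃ VE VG W : ℝ,
        Subshift.HasVariance (BeltBuckle.graph.edgeFun (BeltBuckle.dlx x y)) m VE ∧
        Subshift.HasVariance (BeltBuckle.graph.edgeFun (BeltBuckle.dly x y)) m VG ∧
        Subshift.HasVariance
          (BeltBuckle.graph.edgeFun (BeltBuckle.dlx x y + BeltBuckle.dly x y)) m W ∧
        VE = 2 * BeltBuckle.Sxx x y * p (2, false) ∧
        VE = BeltBuckle.EP x y ∧
        1 / 2 * (W - VE - VG) = 2 * BeltBuckle.Sxy x y * p (2, false) ∧
        1 / 2 * (W - VE - VG) = BeltBuckle.FP x y ∧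
        VG = 2 * BeltBuckle.Syy x y * p (2, false) ∧
        VG = BeltBuckle.GP x y) ∧
      ∀ a b : ℝ,
        Subshift.HasVariance
          (BeltBuckle.graph.edgeFun (a • BeltBuckle.dlx x y + b • BeltBuckle.dly x y)) m
          (a ^ 2 * BeltBuckle.EP x y + 2 * a * b * BeltBuckle.FP x y +
            b ^ 2 * BeltBuckle.GP x y) := by
  have hl := BeltBuckle.sum_sigmoid_neg_l hxy
  refine ⟨(BeltBuckle.isPerronPair hl).existsUnique_isEquilibriumState,
    ⟨_, (BeltBuckle.isStationaryVec_iff hl).2 rfl, fun p => (BeltBuckle.isStationaryVec_iff hl).1⟩,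
    fun m p hm hp => ?_⟩
  have p_eq : p (2, false) = BeltBuckle.p₃ x y :=
    congrFun ((BeltBuckle.isStationaryVec_iff hl).1 hp) (2, false)
  have tangent := BeltBuckle.edgeFun_tangent_mem_tangentSpace hxy hm
  have variance := BeltBuckle.hasVariance_tangent hxy hm
  refine ⟨by simpa using tangent 1 0, by simpa using tangent 0 1,
    ⟨BeltBuckle.EP x y, BeltBuckle.GP x y,
      BeltBuckle.EP x y + 2 * BeltBuckle.FP x y + BeltBuckle.GP x y, by simpa using variance 1 0,
      by simpa using variance 0 1, by simpa using variance 1 1, ?_, rfl, ?_, by ring, ?_, rfl⟩,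
    variance⟩
  · rw [p_eq, BeltBuckle.two_mul_Sxx_mul_p₃ hxy]
  · rw [p_eq, BeltBuckle.two_mul_Sxy_mul_p₃ hxy]
    ring
  · rw [p_eq, BeltBuckle.two_mul_Syy_mul_p₃ hxy]

/-- The map `(x, y) ↦ l(x, y)` parametrizes the moduli space of the belt buckle, and in the
coordinates `(x, y)` the pressure metric has the coefficients `E_P`, `F_P`, `G_P`. -/
theorem proposition4p3 :
    Set.BijOn (fun q : ℝ × ℝ => BeltBuckle.l q.1 q.2) BeltBuckle.domain
      BeltBuckle.graph.moduliOne ∧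
    ∀ x y : ℝ, (x, y) ∈ BeltBuckle.domain →
      (∃! m : Measure (Subshift BeltBuckle.graph.adjMat),
        Subshift.IsEquilibriumState (-BeltBuckle.graph.edgeFun (BeltBuckle.l x y)) m) ∧
      (∃! p : BeltBuckle.graph.DirEdge → ℝ,
        BeltBuckle.graph.IsStationaryVec (BeltBuckle.l x y) p) ∧
      ∀ (m : Measure (Subshift BeltBuckle.graph.adjMat)) (p : BeltBuckle.graph.DirEdge → ℝ),
        Subshift.IsEquilibriumState (-BeltBuckle.graph.edgeFun (BeltBuckle.l x y)) m →
        BeltBuckle.graph.IsStationaryVec (BeltBuckle.l x y) p →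
        -- `∂l/∂x` and `∂l/∂y` are tangent vectors at `l(x, y)`
        ⇑(BeltBuckle.graph.edgeFun (BeltBuckle.dlx x y)) ∈ BeltBuckle.graph.tangentSpace m ∧
        ⇑(BeltBuckle.graph.edgeFun (BeltBuckle.dly x y)) ∈ BeltBuckle.graph.tangentSpace m ∧
        -- the variances, and their polarisation
        (∃ VE VG W : ℝ,
          Subshift.HasVariance (BeltBuckle.graph.edgeFun (BeltBuckle.dlx x y)) m VE ∧
          Subshift.HasVariance (BeltBuckle.graph.edgeFun (BeltBuckle.dly x y)) m VG ∧
          Subshift.HasVariance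
            (BeltBuckle.graph.edgeFun (BeltBuckle.dlx x y + BeltBuckle.dly x y)) m W ∧
          VE = 2 * BeltBuckle.Sxx x y * p (2, false) ∧
          VE = BeltBuckle.EP x y ∧
          1 / 2 * (W - VE - VG) = 2 * BeltBuckle.Sxy x y * p (2, false) ∧
          1 / 2 * (W - VE - VG) = BeltBuckle.FP x y ∧
          VG = 2 * BeltBuckle.Syy x y * p (2, false) ∧
          VG = BeltBuckle.GP x y) ∧
        -- the squared norm of an arbitrary tangent vector `a ∂l/∂x + b ∂l/∂y`
        ∀ a b : ℝ,
          Subshift.HasVariance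
            (BeltBuckle.graph.edgeFun (a • BeltBuckle.dlx x y + b • BeltBuckle.dly x y)) m
            (a ^ 2 * BeltBuckle.EP x y + 2 * a * b * BeltBuckle.FP x y +
              b ^ 2 * BeltBuckle.GP x y) := by
  exact ⟨BeltBuckle.bijOn_l, fun x y ⟨hx, hy, _⟩ => proposition4p3_general (add_pos hx hy)⟩
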